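/- Let $M=\mathbb R^4$ be Minkowski space with time coordinate $x^0$, and let $V^{\pm}=\{p\in\mathbb R^4:\ \pm p_0\ge (p_1^2+p_2^2+p_3^2)^{1/2}\}$ be the closed forward and backward light cones. Write $\mathcal E'(M^d)$ for the compactly supported complex distributions on $M^d$. A *microcausal functional* is a map $A:C^\infty(M,\mathbb R)\to\mathbb C$ that is a finite sum of functionals $$\phi\mapsto\int T(x_1,\dots,x_d)\,\phi(x_1)\cdots\phi(x_d)\,dx_1\cdots dx_d ,\qquad d\ge 0,\ T\in\mathcal E'(M^d),$$ where every $(x_1,\dots,x_d\,|\,p_1,\dots,p_d)$ in the wave front set $\mathrm{WF}(T)$ satisfies $p_1+\dots+p_d=0$. **Proposition.** Let $n,k\ge 0$, let $A_0,\dots,A_n$ be microcausal functionals, and let $s,r:\{1,\dots,k\}\to\{0,\dots,n\}$ satisfy $s(l)<r(l)$ for all $l$. Regard $A_0\otimes\cdots\otimes A_n$ as the functional $(\phi_0,\dots,\phi_n)\mapsto\prod_{i}A_i(\phi_i)$ of $n+1$ field configurations. Then there is a distribution $\Psi\in\mathcal E'(M^{2k})$ with $$\Psi(x_1,\dots,x_k,y_1,\dots,y_k)=\prod_{l=1}^k\frac{\delta^2}{\delta\phi_{s(l)}(x_l)\,\delta\phi_{r(l)}(y_l)}\,(A_0\otimes\cdots\otimes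 A_n)\Big|_{\phi_0=\dots=\phi_n=0},$$ meaning that for all $h_1,\dots,h_k,g_1,\dots,g_k\in C^\infty(M,\mathbb R)$ the value of $\Psi$ on the function $\prod_l h_l(x_l)g_l(y_l)$ is the iterated directional derivative of $A_0\otimes\cdots\otimes A_n$ at $0$, taken for every $l$ once in direction $h_l$ in the argument $\phi_{s(l)}$ and once in direction $g_l$ in the argument $\phi_{r(l)}$. Moreover, for every such $\Psi$, with Fourier transform $\hat\Psi(\xi)=\Psi(e^{-i\langle\xi,\cdot\rangle})$, the function $$P=(p_1,\dots,p_k)\mapsto\hat\Psi(-p_1,\dots,-p_k,p_1,\dots,p_k)$$ is rapidly decreasing in a neighborhood of $(V^+)^k\cup(V^-)^k$: there are an open set $U\supseteq (V^+)^k\cup(V^-)^k$ in $(\mathbb R^4)^k$ and an open set $\Gamma$, invariant under multiplication by positive scalars, with $\big((V^+)^k\cup(V^-)^k\big)\setminus\{0\}\subseteq\Gamma\subseteq U$, such that for every $N\in\mathbb N$ there is a constant $C$ with $(1+\|P\|)^N\,|\hat\Psi(-P,P)|\le C$ for all $P\in U$. -/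

import Mathlib

open scoped ContDiff

noncomputable section

namespace Microcausal

/-- The algebra `C^∞(E, 𝕜)` of smooth functions on a real normed space `E`. -/
def Smooth (𝕜 : Type*) [RCLike 𝕜] (E : Type*) [NormedAddCommGroup E] [NormedSpace ℝ E] :
    Subalgebra 𝕜 (E → 𝕜) where
  carrier := {f | ContDiff ℝ ∞ f}
  mul_mem' {f g} hf hg := by
    have hf' : ContDiff ℝ ∞ f := hf
    have hg' : ContDiff ℝ ∞ g := hg
    exact hf'.mul hg'
  add_mem' {f g} hf hg := by
    have hf' : ContDiff ℝ ∞ f := hf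
    have hg' : ContDiff ℝ ∞ g := hg
    exact hf'.add hg'
  algebraMap_mem' c := by
    change ContDiff ℝ ∞ (fun _ : E => algebraMap 𝕜 𝕜 c)
    exact contDiff_const

/-- A compactly supported (complex) distribution on `E`, i.e. an element of `𝓔'(E)`:
a linear functional on `C^∞(E, ℂ)` that is continuous for the topology of uniform convergence of
all derivatives on compact sets. -/
structure CompactDistribution (E : Type*) [NormedAddCommGroup E] [NormedSpace ℝ E] where
  toLin : Smooth ℂ E →ₗ[ℂ] ℂ
  bound : ∃ K : Set E, IsCompact K ∧ ∃ (N : ℕ) (C : ℝ), ∀ (f : Smooth ℂ E) (B : ℝ), 0 ≤ B →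
    (∀ j ≤ N, ∀ x ∈ K, ‖iteratedFDeriv ℝ j (f : E → ℂ) x‖ ≤ B) → ‖toLin f‖ ≤ C * B

/-- The plane wave `x ↦ exp (- i ⟨ξ, x⟩)`. -/
def planeWave {E : Type*} [NormedAddCommGroup E] [InnerProductSpace ℝ E] (ξ : E) :
    Smooth ℂ E :=
  ⟨fun x => Complex.exp (-(Complex.I * ((inner ℝ ξ x : ℝ) : ℂ))), by
    have h : ContDiff ℝ ∞ (fun x : E => ((inner ℝ ξ x : ℝ) : ℂ)) :=
      Complex.ofRealCLM.contDiff.comp (contDiff_const.inner ℝ contDiff_id)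
    exact (contDiff_const.mul h).neg.cexp⟩

/-- The Fourier transform `ξ ↦ T (exp (- i ⟨ξ, ·⟩))` of a compactly supported distribution. -/
def fourier {E : Type*} [NormedAddCommGroup E] [InnerProductSpace ℝ E]
    (T : CompactDistribution E) (ξ : E) : ℂ :=
  T.toLin (planeWave ξ)

/-- `f` decreases faster than every inverse power of `‖p‖`, uniformly for `p` in `S`. -/
def RapidlyDecreasingOn {E : Type*} [NormedAddCommGroup E] (f : E → ℂ) (S : Set E) : Prop :=
  ∀ N : ℕ, ∃ C : ℝ, ∀ p ∈ S, (1 + ‖p‖) ^ N * ‖f p‖ ≤ C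

/-- Invariance under dilations by positive factors. -/
def IsConic {E : Type*} [NormedAddCommGroup E] [NormedSpace ℝ E] (Γ : Set E) : Prop :=
  ∀ p ∈ Γ, ∀ t : ℝ, 0 < t → t • p ∈ Γ

/-- The wave front set of `T`: the pairs `(x, ξ)` with `ξ ≠ 0` for which there is no cutoff
`χ ∈ C_c^∞` with `χ x ≠ 0` such that the Fourier transform of `χ T` is rapidly decreasing on an
open conic neighbourhood of `ξ`. Covectors are identified with vectors by the Euclidean inner
product, that is, they are given by their coordinates. -/
def waveFrontSet {E : Type*} [NormedAddCommGroup E] [InnerProductSpace ℝ E]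
    (T : CompactDistribution E) : Set (E × E) :=
  {z | z.2 ≠ 0 ∧ ¬ ∃ χ : Smooth ℂ E, HasCompactSupport (χ : E → ℂ) ∧ (χ : E → ℂ) z.1 ≠ 0 ∧
    ∃ Γ : Set E, IsOpen Γ ∧ IsConic Γ ∧ z.2 ∈ Γ ∧
      RapidlyDecreasingOn (fun η => T.toLin (χ * planeWave η)) Γ}

/-- Minkowski space `M = ℝ⁴`, the coordinate `0` being time. -/
abbrev M : Type := EuclideanSpace ℝ (Fin 4)

/-- The power `M^ι`, as a Euclidean space. -/
abbrev MPow (ι : Type) [Fintype ι] : Type := PiLp 2 (fun _ : ι => M)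

/-- The closed forward light cone `V⁺`. -/
def forwardCone : Set M := {p | 0 ≤ p 0 ∧ p 1 ^ 2 + p 2 ^ 2 + p 3 ^ 2 ≤ p 0 ^ 2}

/-- The closed backward light cone `V⁻`. -/
def backwardCone : Set M := {p | p 0 ≤ 0 ∧ p 1 ^ 2 + p 2 ^ 2 + p 3 ^ 2 ≤ p 0 ^ 2}

/-- The union `(V⁺)^k ∪ (V⁻)^k` of the `k`-fold products of the light cones. -/
def coneUnion (k : ℕ) : Set (MPow (Fin k)) :=
  {P | ∀ l, P l ∈ forwardCone} ∪ {P | ∀ l, P l ∈ backwardCone}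

/-- Classical field configurations: real smooth functions on `M`. -/
abbrev Config : Type := Smooth ℝ M

/-- The tensor product `x ↦ ∏ j, h j (x j)` as a smooth function on `M^ι`. -/
def tensorFn {ι : Type} [Fintype ι] (h : ι → Config) : Smooth ℂ (MPow ι) :=
  ⟨fun x => ∏ j, (((h j : M → ℝ) (x j) : ℝ) : ℂ), by
    have key : ∀ j, ContDiff ℝ ∞ (fun x : MPow ι => (((h j : M → ℝ) (x j) : ℝ) : ℂ)) := by
      intro j
      have h1 : ContDiff ℝ ∞ (h j : M → ℝ) := (h j).2
      have h2 : ContDiff ℝ ∞ (fun x : MPow ι => x j) := contDiff_piLp_apply 2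
      exact Complex.ofRealCLM.contDiff.comp (h1.comp h2)
    change ContDiff ℝ ∞ (fun x : MPow ι => ∏ j, (((h j : M → ℝ) (x j) : ℝ) : ℂ))
    exact contDiff_prod fun j _ => key j⟩

/-- Microcausal functionals: finite sums of functionals
`φ ↦ ∫ T(x₁, …, x_d) φ(x₁) ⋯ φ(x_d) dx₁ ⋯ dx_d`, where `T ∈ 𝓔'(M^d)` is such that every
`(x₁, …, x_d | p₁, …, p_d)` in its wave front set satisfies `p₁ + ⋯ + p_d = 0`. -/
def IsMicrocausal (F : Config → ℂ) : Prop :=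
  ∃ (m : ℕ) (d : Fin m → ℕ) (T : ∀ a, CompactDistribution (MPow (Fin (d a)))),
    (∀ a, ∀ z ∈ waveFrontSet (T a), ∑ j, z.2 j = 0) ∧
    ∀ φ : Config, F φ = ∑ a, (T a).toLin (tensorFn fun _ => φ)

/-- The tensor product `A₀ ⊗ ⋯ ⊗ A_n`, a functional of `n + 1` field configurations. -/
def tensorFunctional {n : ℕ} (A : Fin (n + 1) → Config → ℂ) (φ : Fin (n + 1) → Config) : ℂ :=
  ∏ i, A i (φ i)

/-- The functional derivative `∫ (δ G / δφ_i(x)) h(x) dx` smeared with `h`, that is, the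
directional derivative of `G` in the direction `h` of its `i`-th argument. -/
def funDeriv {n : ℕ} (i : Fin (n + 1)) (h : Config) (G : (Fin (n + 1) → Config) → ℂ) :
    (Fin (n + 1) → Config) → ℂ :=
  fun φ => lineDeriv ℝ G φ (Pi.single i h)

/-- The product over `l` of the second functional derivatives
`δ² / δφ_{s(l)}(x_l) δφ_{r(l)}(y_l)`, smeared with `h l` in `x_l` and with `g l` in `y_l`. -/
def iteratedFunDeriv {n k : ℕ} (s r : Fin k → Fin (n + 1)) (h g : Fin k → Config)
    (G : (Fin (n + 1) → Config) → ℂ) : (Fin (n + 1) → Config) → ℂ :=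
  (List.finRange k).foldr (fun l G' => funDeriv (s l) (h l) (funDeriv (r l) (g l) G')) G

/-- `Ψ(x₁, …, x_k, y₁, …, y_k)` is the distribution
`∏_l δ² / δφ_{s(l)}(x_l) δφ_{r(l)}(y_l) (A₀ ⊗ ⋯ ⊗ A_n)` at `φ₀ = ⋯ = φ_n = 0`.
The left summand of the index type carries the `x_l`, the right one the `y_l`. -/
def IsDerivativeDistribution {n k : ℕ} (A : Fin (n + 1) → Config → ℂ)
    (s r : Fin k → Fin (n + 1)) (Ψ : CompactDistribution (MPow (Fin k ⊕ Fin k))) : Prop :=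
  ∀ h g : Fin k → Config,
    Ψ.toLin (tensorFn (Sum.elim h g)) = iteratedFunDeriv s r h g (tensorFunctional A) 0

/-- The point `(-P, P) = (-p₁, …, -p_k, p₁, …, p_k)`. -/
def negPair {k : ℕ} (P : MPow (Fin k)) : MPow (Fin k ⊕ Fin k) :=
  WithLp.toLp 2 (Sum.elim (fun l => -P l) (fun l => P l))

end Microcausal

end

/-! By multilinearity one may take each `A i` to be a monomial given by a single distribution T_i.
The product is then the diagonal of one multilinear map with slots (i, j). Its derivative at 0 is a
finite sum over bijections `e` from the 2k directions to the slots; a bijection survives only if x_l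
lands in a slot of T_{s(l)} and y_l in a slot of T_{r(l)}. Each surviving term is a relabelled
tensor product of the T_i, so at (-P, P) its Fourier transform is the product of the Fourier
transforms of the T_i at the momenta reaching vertex i (`exists_derivative_of_sigma_product`).

The causal input is `exists_sum_vertexMomenta_ne_zero_of_forward`. For nonzero P in (V⁺)^k, let i be
the smallest s(l) over the lines with p_l ≠ 0. Since s(l) < r(l), no line with nonzero momentum ends
at i, so only terms -p_l with s(l) = i contribute there, and the total energy at i is strictly
negative. Momentum is thus not conserved at i, the direction lies outside the wave front set of T_i
over every point, and by a partition of unity (`CompactDistribution.rapidNear_fourier`) the Fourier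
transform of T_i decays rapidly near it. The other factors grow at most polynomially, and ‖P‖ is
comparable to the size of the momenta at i near the chosen direction. The backward cone follows from
P ↦ -P, and compactness of the unit sphere in the closed cone gives a uniform neighbourhood.

Values on real tensor products determine the Fourier transform, because a plane wave is a finite
complex combination of such products. Hence one constructed Ψ settles every Ψ, and no density
theorem is needed. -/

open scoped ContDiff

noncomputable section

namespace Microcausal

/-! ### Factoring functionals through normed spaces -/

section Representation

/-- A linear functional that is controlled by the norm of a linear map `L` factors through a
continuous linear functional (Hahn-Banach). -/
theorem exists_dual_comp_eq {V X : Type*} [AddCommGroup V] [Module ℂ V] [NormedAddCommGroup X]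
    [NormedSpace ℂ X] (L : V →ₗ[ℂ] X) (Λ : V →ₗ[ℂ] ℂ) (C : ℝ) (h : ∀ v, ‖Λ v‖ ≤ C * ‖L v‖) :
    ∃ Φ : X →L[ℂ] ℂ, ∀ v, Φ (L v) = Λ v := by
  -- The bound makes `Λ` vanish on the kernel of `L`, so it factors algebraically; the same bound
  -- makes the factor continuous on the range.
  have hΛ : Λ ∈ LinearMap.range L.dualMap := by
    rw [LinearMap.range_dualMap_eq_dualAnnihilator_ker, Submodule.mem_dualAnnihilator]
    intro v hv
    rw [LinearMap.mem_ker] at hv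
    simpa [hv] using h v
  obtain ⟨f, rfl⟩ := hΛ
  obtain ⟨g, hg, -⟩ := exists_extension_norm_eq (LinearMap.range L)
    ((f ∘ₗ (LinearMap.range L).subtype).mkContinuous C (by
      rintro ⟨_, v, rfl⟩
      exact h v))
  exact ⟨g, fun v => hg ⟨L v, v, rfl⟩⟩

end Representation

/-! ### Smooth functions and their jets -/

section SmoothFunctions

variable {E F : Type*} [NormedAddCommGroup E] [NormedSpace ℝ E] [NormedAddCommGroup F]
  [NormedSpace ℝ F]

theorem Smooth.contDiff {𝕜 : Type*} [RCLike 𝕜] (f : Smooth 𝕜 E) :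
    ContDiff ℝ ∞ (f : E → 𝕜) := f.2

theorem Smooth.contDiffAt_nat (f : Smooth ℂ E) (j : ℕ) (x : E) :
    ContDiffAt ℝ j (f : E → ℂ) x :=
  ((Smooth.contDiff f).of_le (by exact_mod_cast le_top)).contDiffAt

theorem Smooth.iteratedFDeriv_add (f g : Smooth ℂ E) (j : ℕ) (x : E) :
    iteratedFDeriv ℝ j ((f + g : Smooth ℂ E) : E → ℂ) x =
      iteratedFDeriv ℝ j (f : E → ℂ) x + iteratedFDeriv ℝ j (g : E → ℂ) x :=
  iteratedFDeriv_add_apply (Smooth.contDiffAt_nat f j x) (Smooth.contDiffAt_nat g j x)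

theorem Smooth.iteratedFDeriv_smul (c : ℂ) (f : Smooth ℂ E) (j : ℕ) (x : E) :
    iteratedFDeriv ℝ j ((c • f : Smooth ℂ E) : E → ℂ) x =
      c • iteratedFDeriv ℝ j (f : E → ℂ) x :=
  iteratedFDeriv_const_smul_apply (Smooth.contDiffAt_nat f j x)

/-- Composition of smooth functions with a continuous linear map. -/
def Smooth.compCLM (A : E →L[ℝ] F) : Smooth ℂ F →ₗ[ℂ] Smooth ℂ E where
  toFun f := ⟨fun x => (f : F → ℂ) (A x), (Smooth.contDiff f).comp A.contDiff⟩
  map_add' _ _ := rfl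
  map_smul' _ _ := rfl

@[simp]
theorem Smooth.compCLM_apply (A : E →L[ℝ] F) (f : Smooth ℂ F) (x : E) :
    (Smooth.compCLM A f : E → ℂ) x = (f : F → ℂ) (A x) := rfl

/-- The directional derivative of smooth functions in a fixed direction. -/
def Smooth.dirDeriv (v : E) : Smooth ℂ E →ₗ[ℂ] Smooth ℂ E where
  toFun f := ⟨fun x => fderiv ℝ (f : E → ℂ) x v,
    ((Smooth.contDiff f).fderiv_right (m := ∞) (by simp)).clm_apply contDiff_const⟩
  map_add' f g := by
    ext x
    change fderiv ℝ ((f : E → ℂ) + (g : E → ℂ)) x v = _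
    rw [fderiv_add ((Smooth.contDiff f).differentiable (by simp) x)
      ((Smooth.contDiff g).differentiable (by simp) x)]
    rfl
  map_smul' c f := by
    ext x
    change fderiv ℝ (c • (f : E → ℂ)) x v = _
    rw [fderiv_const_smul ((Smooth.contDiff f).differentiable (by simp) x)]
    rfl

theorem Smooth.dirDeriv_apply (v : E) (f : Smooth ℂ E) (x : E) :
    (Smooth.dirDeriv v f : E → ℂ) x = fderiv ℝ (f : E → ℂ) x v := rfl

/-- Peeling off the last direction turns a higher derivative into a lower one of another element of
`Smooth`, which is what inductions on the order use. -/
theorem Smooth.iteratedFDeriv_snoc (f : Smooth ℂ E) (x : E) {j : ℕ} (m : Fin j → E) (v : E) :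
    iteratedFDeriv ℝ (j + 1) (f : E → ℂ) x (Fin.snoc m v : Fin (j + 1) → E) =
      iteratedFDeriv ℝ j (Smooth.dirDeriv v f : E → ℂ) x m := by
  rw [iteratedFDeriv_succ_apply_right, Fin.init_snoc, Fin.snoc_last]
  have h : (Smooth.dirDeriv v f : E → ℂ) =
      (ContinuousLinearMap.apply ℝ ℂ v) ∘ (fun y => fderiv ℝ (f : E → ℂ) y) := rfl
  rw [h, ContinuousLinearMap.iteratedFDeriv_comp_left (n := ∞) _
    ((Smooth.contDiff f).fderiv_right (m := ∞) (by simp)).contDiffAt (by exact_mod_cast le_top)]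
  rfl

/-- The map `f ↦ D^j f (x) m` as a linear functional. -/
def Smooth.jetCoord (j : ℕ) (x : E) (m : Fin j → E) : Smooth ℂ E →ₗ[ℂ] ℂ where
  toFun f := iteratedFDeriv ℝ j (f : E → ℂ) x m
  map_add' f g := by rw [Smooth.iteratedFDeriv_add]; rfl
  map_smul' c f := by rw [Smooth.iteratedFDeriv_smul]; rfl

/-- The Banach space of `N`-jets along the compact set `K`. -/
def JetSpace (K : Set E) (N : ℕ) : Type _ := ∀ j : Fin (N + 1), C(K, E [×j]→L[ℝ] ℂ)

instance (K : Set E) (N : ℕ) [CompactSpace K] : NormedAddCommGroup (JetSpace K N) :=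
  inferInstanceAs (NormedAddCommGroup (∀ j : Fin (N + 1), C(K, E [×j]→L[ℝ] ℂ)))

instance (K : Set E) (N : ℕ) [CompactSpace K] : NormedSpace ℂ (JetSpace K N) :=
  inferInstanceAs (NormedSpace ℂ (∀ j : Fin (N + 1), C(K, E [×j]→L[ℝ] ℂ)))

instance (K : Set E) (N : ℕ) [CompactSpace K] : CompleteSpace (JetSpace K N) :=
  inferInstanceAs (CompleteSpace (∀ j : Fin (N + 1), C(K, E [×j]→L[ℝ] ℂ)))

/-- The restriction to `K` of the derivatives of order at most `N`. -/
def jet (K : Set E) [CompactSpace K] (N : ℕ) : Smooth ℂ E →ₗ[ℂ] JetSpace K N where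
  toFun f j := ⟨fun x => iteratedFDeriv ℝ j (f : E → ℂ) x,
    ((Smooth.contDiff f).continuous_iteratedFDeriv (by exact_mod_cast le_top)).comp
      continuous_subtype_val⟩
  map_add' f g := by
    funext j
    apply ContinuousMap.ext
    intro x
    exact Smooth.iteratedFDeriv_add f g j x
  map_smul' c f := by
    funext j
    apply ContinuousMap.ext
    intro x
    exact Smooth.iteratedFDeriv_smul c f j x

theorem norm_iteratedFDeriv_le_norm_jet {K : Set E} [CompactSpace K] {N : ℕ} (f : Smooth ℂ E)
    {j : ℕ} (hj : j ≤ N) {x : E} (hx : x ∈ K) :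
    ‖iteratedFDeriv ℝ j (f : E → ℂ) x‖ ≤ ‖jet K N f‖ :=
  ((jet K N f ⟨j, by omega⟩).norm_coe_le_norm ⟨x, hx⟩).trans
    (norm_le_pi_norm (f := (jet K N f : ∀ j : Fin (N + 1), C(K, E [×j]→L[ℝ] ℂ))) ⟨j, by omega⟩)

theorem norm_jet_le {K : Set E} [CompactSpace K] {N : ℕ} (f : Smooth ℂ E) {B : ℝ} (hB : 0 ≤ B)
    (h : ∀ j ≤ N, ∀ x ∈ K, ‖iteratedFDeriv ℝ j (f : E → ℂ) x‖ ≤ B) : ‖jet K N f‖ ≤ B :=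
  (pi_norm_le_iff_of_nonneg hB).2 fun j =>
    (ContinuousMap.norm_le _ hB).2 fun x => h j (by omega) x x.2

end SmoothFunctions

/-! ### Operations on compactly supported distributions -/

namespace CompactDistribution

variable {E F : Type*} [NormedAddCommGroup E] [NormedSpace ℝ E] [NormedAddCommGroup F]
  [NormedSpace ℝ F]

theorem exists_nonneg_bound (T : CompactDistribution E) : ∃ K : Set E, IsCompact K ∧
    ∃ (N : ℕ) (C : ℝ), 0 ≤ C ∧ ∀ (f : Smooth ℂ E) (B : ℝ), 0 ≤ B →
      (∀ j ≤ N, ∀ x ∈ K, ‖iteratedFDeriv ℝ j (f : E → ℂ) x‖ ≤ B) → ‖T.toLin f‖ ≤ C * B := by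
  obtain ⟨K, hK, N, C, h⟩ := T.bound
  exact ⟨K, hK, N, max C 0, le_max_right _ _, fun f B hB hf =>
    (h f B hB hf).trans (mul_le_mul_of_nonneg_right (le_max_left _ _) hB)⟩

/-- A compactly supported distribution is a continuous functional of jets. -/
theorem exists_eq_dual_jet (T : CompactDistribution E) : ∃ (K : Set E) (_ : CompactSpace K)
    (N : ℕ) (Φ : JetSpace K N →L[ℂ] ℂ), ∀ f, Φ (jet K N f) = T.toLin f := by
  obtain ⟨K, hK, N, C, -, h⟩ := T.exists_nonneg_bound
  have := isCompact_iff_compactSpace.1 hK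
  obtain ⟨Φ, hΦ⟩ := exists_dual_comp_eq (jet K N) T.toLin C fun f =>
    h f _ (norm_nonneg _) fun j hj x hx => norm_iteratedFDeriv_le_norm_jet f hj hx
  exact ⟨K, this, N, Φ, hΦ⟩

/-- The compactly supported distribution given by a continuous functional of jets. -/
def ofJet (K : Set E) [hK : CompactSpace K] (N : ℕ) (Φ : JetSpace K N →L[ℂ] ℂ) :
    CompactDistribution E where
  toLin := Φ.toLinearMap ∘ₗ jet K N
  bound := ⟨K, isCompact_iff_compactSpace.2 hK, N, ‖Φ‖, fun f _ hB h =>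
    (Φ.le_opNorm _).trans (mul_le_mul_of_nonneg_left (norm_jet_le f hB h) (norm_nonneg _))⟩

/-- A finite sum of compactly supported distributions. -/
theorem exists_sum {ι : Type*} (s : List ι) (T : ι → CompactDistribution E) :
    ∃ S : CompactDistribution E, ∀ f, S.toLin f = (s.map fun i => (T i).toLin f).sum := by
  induction s with
  | nil => exact ⟨⟨0, ∅, isCompact_empty, 0, 0, by simp⟩, by simp⟩
  | cons a s ih =>
    obtain ⟨S, hS⟩ := ih
    obtain ⟨K₁, hK₁, N₁, C₁, -, h₁⟩ := (T a).exists_nonneg_bound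
    obtain ⟨K₂, hK₂, N₂, C₂, -, h₂⟩ := S.exists_nonneg_bound
    refine ⟨⟨(T a).toLin + S.toLin, K₁ ∪ K₂, hK₁.union hK₂, max N₁ N₂, C₁ + C₂,
      fun f B hB h => ?_⟩, fun f => by simp [hS]⟩
    rw [add_mul]
    exact (norm_add_le _ _).trans (add_le_add
      (h₁ f B hB fun j hj x hx => h j (hj.trans (le_max_left _ _)) x (Or.inl hx))
      (h₂ f B hB fun j hj x hx => h j (hj.trans (le_max_right _ _)) x (Or.inr hx)))

/-- The push-forward of a compactly supported distribution under a continuous linear map. -/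
def map (A : E →L[ℝ] F) (T : CompactDistribution E) : CompactDistribution F where
  toLin := T.toLin ∘ₗ Smooth.compCLM A
  bound := by
    obtain ⟨K, hK, N, C, hC, h⟩ := T.exists_nonneg_bound
    -- The chain rule costs ‖A‖^j with j ≤ N; the base 1 + ‖A‖ ≥ 1 makes the power monotone in j.
    refine ⟨A '' K, hK.image A.continuous, N, C * (1 + ‖A‖) ^ N, fun f B hB hf => ?_⟩
    rw [mul_assoc]
    refine h _ _ (by positivity) fun j hj x hx => ?_
    have hc : ((Smooth.compCLM A f : Smooth ℂ E) : E → ℂ) = (f : F → ℂ) ∘ A := rfl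
    rw [hc, A.iteratedFDeriv_comp_right (Smooth.contDiff f) x (by exact_mod_cast le_top)]
    refine (ContinuousMultilinearMap.norm_compContinuousLinearMap_le _ _).trans ?_
    rw [Finset.prod_const, Finset.card_univ, Fintype.card_fin, mul_comm]
    have h1 : (1 : ℝ) ≤ 1 + ‖A‖ := by linarith [norm_nonneg A]
    exact mul_le_mul ((pow_le_pow_left₀ (norm_nonneg _) (by linarith) j).trans
      (pow_le_pow_right₀ h1 hj)) (hf j hj _ ⟨x, hx, rfl⟩) (norm_nonneg _) (by positivity)

@[simp]
theorem map_toLin (A : E →L[ℝ] F) (T : CompactDistribution E) (f : Smooth ℂ F) :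
    (T.map A).toLin f = T.toLin (Smooth.compCLM A f) := rfl

/-- The product of a compactly supported distribution with a smooth function. -/
def smul (χ : Smooth ℂ E) (T : CompactDistribution E) : CompactDistribution E where
  toLin := T.toLin ∘ₗ LinearMap.mulLeft ℂ χ
  bound := by
    obtain ⟨K, hK, N, C, hC, h⟩ := T.exists_nonneg_bound
    have := isCompact_iff_compactSpace.1 hK
    refine ⟨K, hK, N, C * (2 ^ N * ‖jet K N χ‖), fun f B hB hf => ?_⟩
    rw [mul_assoc]
    refine h _ _ (by positivity) fun j hj x hx => ?_
    have hm : ((LinearMap.mulLeft ℂ χ f : Smooth ℂ E) : E → ℂ) =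
      fun y => (χ : E → ℂ) y * (f : E → ℂ) y := rfl
    rw [hm]
    refine (norm_iteratedFDeriv_mul_le (Smooth.contDiff χ) (Smooth.contDiff f) x
      (by exact_mod_cast le_top)).trans ?_
    calc _ ≤ ∑ i ∈ Finset.range (j + 1), (j.choose i : ℝ) * (‖jet K N χ‖ * B) := by
          refine Finset.sum_le_sum fun i hi => ?_
          rw [Finset.mem_range] at hi
          rw [mul_assoc]
          gcongr
          · exact norm_iteratedFDeriv_le_norm_jet χ (by omega) hx
          · exact hf _ (by omega) x hx
      _ = 2 ^ j * (‖jet K N χ‖ * B) := by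
          rw [← Finset.sum_mul]
          congr 1
          exact_mod_cast Nat.sum_range_choose j
      _ ≤ 2 ^ N * ‖jet K N χ‖ * B := by
          rw [mul_assoc]
          gcongr
          norm_num

@[simp]
theorem smul_toLin (χ : Smooth ℂ E) (T : CompactDistribution E) (f : Smooth ℂ E) :
    (T.smul χ).toLin f = T.toLin (χ * f) := rfl

/-- The point evaluation at the origin. -/
def dirac : CompactDistribution E where
  toLin := { toFun := fun f => (f : E → ℂ) 0, map_add' := fun _ _ => rfl,
             map_smul' := fun _ _ => rfl }
  bound := ⟨{0}, isCompact_singleton, 0, 1, fun f B _ h => by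
    simpa using h 0 le_rfl 0 rfl⟩

/-- The value of a compactly supported distribution depends only on the function near a
suitable compact set. -/
theorem exists_isCompact_congr (T : CompactDistribution E) : ∃ K : Set E, IsCompact K ∧
    ∀ f g : Smooth ℂ E, (∀ x ∈ K, (f : E → ℂ) =ᶠ[nhds x] (g : E → ℂ)) →
      T.toLin f = T.toLin g := by
  obtain ⟨K, hK, N, C, hC, h⟩ := T.exists_nonneg_bound
  refine ⟨K, hK, fun f g hfg => ?_⟩
  -- All derivatives of f - g vanish on K, so the seminorm estimate applies with bound 0.
  have h0 := h (f - g) 0 le_rfl fun j hj x hx => by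
    have hz : ((f - g : Smooth ℂ E) : E → ℂ) =ᶠ[nhds x] fun _ => (0 : ℂ) := by
      filter_upwards [hfg x hx] with y hy
      change (f : E → ℂ) y - (g : E → ℂ) y = 0
      rw [hy, sub_self]
    rw [(hz.iteratedFDeriv ℝ j).eq_of_nhds]
    simp
  rw [mul_zero, norm_le_zero_iff, map_sub, sub_eq_zero] at h0
  exact h0

end CompactDistribution

/-! ### Tensor products of distributions -/

section Tensor

open scoped TensorProduct

variable {E F : Type*} [NormedAddCommGroup E] [NormedSpace ℝ E] [NormedAddCommGroup F]
  [NormedSpace ℝ F]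

/-- The function `(x, y) ↦ u x * v y`. -/
def Smooth.outer (u : Smooth ℂ E) (v : Smooth ℂ F) : Smooth ℂ (E × F) :=
  Smooth.compCLM (ContinuousLinearMap.fst ℝ E F) u *
    Smooth.compCLM (ContinuousLinearMap.snd ℝ E F) v

theorem Smooth.outer_apply (u : Smooth ℂ E) (v : Smooth ℂ F) (z : E × F) :
    (Smooth.outer u v : E × F → ℂ) z = (u : E → ℂ) z.1 * (v : F → ℂ) z.2 := rfl

theorem Smooth.fderiv_outer (u : Smooth ℂ E) (v : Smooth ℂ F) (z : E × F) :
    fderiv ℝ (Smooth.outer u v : E × F → ℂ) z =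
      (u : E → ℂ) z.1 • fderiv ℝ (v : F → ℂ) z.2 ∘SL ContinuousLinearMap.snd ℝ E F +
        (v : F → ℂ) z.2 • fderiv ℝ (u : E → ℂ) z.1 ∘SL ContinuousLinearMap.fst ℝ E F :=
  HasFDerivAt.fderiv
    ((((Smooth.contDiff u).differentiable (by simp) z.1).hasFDerivAt.comp z hasFDerivAt_fst).mul
      (((Smooth.contDiff v).differentiable (by simp) z.2).hasFDerivAt.comp z hasFDerivAt_snd))

theorem Smooth.dirDeriv_outer_left (a : E) (u : Smooth ℂ E) (v : Smooth ℂ F) :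
    Smooth.dirDeriv (a, (0 : F)) (Smooth.outer u v) = Smooth.outer (Smooth.dirDeriv a u) v := by
  ext z
  rw [Smooth.dirDeriv_apply, Smooth.outer_apply, Smooth.dirDeriv_apply, Smooth.fderiv_outer]
  simp [mul_comm]

theorem Smooth.dirDeriv_outer_right (b : F) (u : Smooth ℂ E) (v : Smooth ℂ F) :
    Smooth.dirDeriv ((0 : E), b) (Smooth.outer u v) = Smooth.outer u (Smooth.dirDeriv b v) := by
  ext z
  rw [Smooth.dirDeriv_apply, Smooth.outer_apply, Smooth.dirDeriv_apply, Smooth.fderiv_outer]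
  simp

theorem Smooth.iteratedFDeriv_outer_left {j : ℕ} (a : Fin j → E) (u : Smooth ℂ E)
    (v : Smooth ℂ F) (z : E × F) :
    iteratedFDeriv ℝ j (Smooth.outer u v : E × F → ℂ) z (fun i => (a i, (0 : F))) =
      iteratedFDeriv ℝ j (u : E → ℂ) z.1 a * (v : F → ℂ) z.2 := by
  induction j generalizing u with
  | zero => simp [Smooth.outer_apply]
  | succ j ih =>
    rw [← Fin.snoc_init_self a]
    have h : (fun i => ((Fin.snoc (Fin.init a) (a (Fin.last j)) : Fin (j + 1) → E) i, (0 : F))) =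
        (Fin.snoc (fun i => (Fin.init a i, (0 : F))) (a (Fin.last j), (0 : F)) :
          Fin (j + 1) → E × F) := by
      funext i
      refine Fin.lastCases ?_ (fun i => ?_) i <;> simp
    rw [h, Smooth.iteratedFDeriv_snoc, Smooth.iteratedFDeriv_snoc, Smooth.dirDeriv_outer_left, ih]

theorem Smooth.iteratedFDeriv_outer {i j : ℕ} (a : Fin j → E) (b : Fin i → F) (u : Smooth ℂ E)
    (v : Smooth ℂ F) (z : E × F) :
    iteratedFDeriv ℝ (j + i) (Smooth.outer u v : E × F → ℂ) z
        (Fin.append (fun l => (a l, (0 : F))) (fun l => ((0 : E), b l))) =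
      iteratedFDeriv ℝ j (u : E → ℂ) z.1 a * iteratedFDeriv ℝ i (v : F → ℂ) z.2 b := by
  induction i generalizing v with
  | zero =>
    have h : (Fin.append (fun l => (a l, (0 : F))) (fun l => ((0 : E), b l))) =
        fun l => (a l, (0 : F)) := by
      funext l
      exact Fin.append_left _ _ l
    rw [iteratedFDeriv_zero_apply, ← Smooth.iteratedFDeriv_outer_left]
    exact congrArg _ h
  | succ i ih =>
    have h : (fun l => ((0 : E), b l)) =
        (Fin.snoc (fun l => ((0 : E), Fin.init b l)) ((0 : E), b (Fin.last i)) :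
          Fin (i + 1) → E × F) := by
      funext l
      refine Fin.lastCases ?_ (fun l => ?_) l <;> simp [Fin.init]
    rw [h, Fin.append_snoc]
    refine (Smooth.iteratedFDeriv_snoc (j := j + i) _ _ _ _).trans ?_
    rw [Smooth.dirDeriv_outer_right, ih]
    conv_rhs => rw [← Fin.snoc_init_self b, Smooth.iteratedFDeriv_snoc]

/-- The linear map `u ⊗ v ↦ u(x) v(y)`. -/
def Smooth.outerLin : Smooth ℂ E ⊗[ℂ] Smooth ℂ F →ₗ[ℂ] Smooth ℂ (E × F) :=
  TensorProduct.lift (LinearMap.mk₂ ℂ Smooth.outer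
    (fun u u' v => by simp [Smooth.outer, add_mul]) (fun c u v => by simp [Smooth.outer])
    (fun u v v' => by simp [Smooth.outer, mul_add]) (fun c u v => by simp [Smooth.outer]))

/-- Contraction of the left factor with a linear functional. -/
def contractLeft {V W : Type*} [AddCommGroup V] [Module ℂ V] [AddCommGroup W] [Module ℂ W]
    (S : V →ₗ[ℂ] ℂ) : V ⊗[ℂ] W →ₗ[ℂ] W :=
  TensorProduct.lid ℂ W ∘ₗ TensorProduct.map S LinearMap.id

/-- Contraction of the right factor with a linear functional. -/
def contractRight {V W : Type*} [AddCommGroup V] [Module ℂ V] [AddCommGroup W] [Module ℂ W]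
    (T : W →ₗ[ℂ] ℂ) : V ⊗[ℂ] W →ₗ[ℂ] V :=
  TensorProduct.rid ℂ V ∘ₗ TensorProduct.map LinearMap.id T

@[simp]
theorem contractLeft_tmul {V W : Type*} [AddCommGroup V] [Module ℂ V] [AddCommGroup W]
    [Module ℂ W] (S : V →ₗ[ℂ] ℂ) (v : V) (w : W) : contractLeft S (v ⊗ₜ[ℂ] w) = S v • w := by
  simp [contractLeft]

@[simp]
theorem contractRight_tmul {V W : Type*} [AddCommGroup V] [Module ℂ V] [AddCommGroup W]
    [Module ℂ W] (T : W →ₗ[ℂ] ℂ) (v : V) (w : W) : contractRight T (v ⊗ₜ[ℂ] w) = T w • v := by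
  simp [contractRight]

/-- An algebraic Fubini theorem: it lets the estimates for the two factors be applied one after the
other. -/
theorem apply_contractRight {V W : Type*} [AddCommGroup V] [Module ℂ V] [AddCommGroup W]
    [Module ℂ W] (S : V →ₗ[ℂ] ℂ) (T : W →ₗ[ℂ] ℂ) (z : V ⊗[ℂ] W) :
    S (contractRight T z) = T (contractLeft S z) := by
  induction z with
  | zero => simp
  | tmul v w => simp [mul_comm]
  | add z z' h h' => simp [h, h']

/-- Derivatives in x and then in y are mixed derivatives of the function on the product, so iterated
contractions are controlled by jets on E × F. -/
theorem Smooth.jetCoord_contractLeft {i j : ℕ} (a : Fin j → E) (b : Fin i → F) (x : E) (y : F)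
    (z : Smooth ℂ E ⊗[ℂ] Smooth ℂ F) :
    Smooth.jetCoord i y b (contractLeft (Smooth.jetCoord j x a) z) =
      Smooth.jetCoord (j + i) (x, y)
        (Fin.append (fun l => (a l, (0 : F))) (fun l => ((0 : E), b l))) (Smooth.outerLin z) := by
  induction z with
  | zero => simp
  | tmul u v =>
    rw [contractLeft_tmul, map_smul]
    exact (Smooth.iteratedFDeriv_outer a b u v (x, y)).symm
  | add z z' h h' => simp [h, h']

/-- Tensor product of two compactly supported distributions. -/
theorem CompactDistribution.exists_outer (S : CompactDistribution E) (T : CompactDistribution F) :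
    ∃ R : CompactDistribution (E × F), ∀ u v,
      R.toLin (Smooth.outer u v) = S.toLin u * T.toLin v := by
  obtain ⟨K₁, hK₁, N₁, C₁, hC₁, h₁⟩ := S.exists_nonneg_bound
  obtain ⟨K₂, hK₂, N₂, C₂, hC₂, h₂⟩ := T.exists_nonneg_bound
  have := isCompact_iff_compactSpace.1 (hK₁.prod hK₂)
  let _ : AddCommGroup (Smooth ℂ E ⊗[ℂ] Smooth ℂ F) := TensorProduct.addCommGroup
  let L : Smooth ℂ E ⊗[ℂ] Smooth ℂ F →ₗ[ℂ] JetSpace (K₁ ×ˢ K₂) (N₁ + N₂) :=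
    jet (K₁ ×ˢ K₂) (N₁ + N₂) ∘ₗ Smooth.outerLin
  -- On the algebraic tensor product, the estimate for S and then that for T bound S ⊗ T by the (N₁
  -- + N₂)-jet on K₁ × K₂; Hahn-Banach extends it to all jets.
  obtain ⟨Φ, hΦ⟩ := exists_dual_comp_eq L (S.toLin ∘ₗ contractRight T.toLin) (C₁ * C₂) (by
    intro z
    rw [mul_assoc]
    refine h₁ _ _ (by positivity) fun j hj x hx => ?_
    refine ContinuousMultilinearMap.opNorm_le_bound (by positivity) fun a => ?_
    change ‖Smooth.jetCoord j x a (contractRight T.toLin z)‖ ≤ _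
    rw [apply_contractRight, mul_assoc]
    refine h₂ _ _ (by positivity) fun i hi y hy => ?_
    refine ContinuousMultilinearMap.opNorm_le_bound (by positivity) fun b => ?_
    change ‖Smooth.jetCoord i y b _‖ ≤ _
    rw [Smooth.jetCoord_contractLeft]
    refine (ContinuousMultilinearMap.le_opNorm _ _).trans ?_
    rw [Fin.prod_univ_add, mul_assoc]
    refine mul_le_mul (norm_iteratedFDeriv_le_norm_jet _ (by omega) (Set.mk_mem_prod hx hy))
      (le_of_eq ?_) (by positivity) (norm_nonneg _)
    simp [Prod.norm_def])
  refine ⟨.ofJet (K₁ ×ˢ K₂) (N₁ + N₂) Φ, fun u v => ?_⟩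
  have h := hΦ (u ⊗ₜ[ℂ] v)
  simp only [LinearMap.comp_apply, contractRight_tmul, map_smul, smul_eq_mul] at h
  rw [mul_comm, ← h]
  rfl

/-- The function `x ↦ ∏ i, u i (x i)`. -/
def Smooth.piOuter {n : ℕ} {E : Fin n → Type} [∀ i, NormedAddCommGroup (E i)]
    [∀ i, NormedSpace ℝ (E i)] (u : ∀ i, Smooth ℂ (E i)) : Smooth ℂ (∀ i, E i) :=
  ∏ i, Smooth.compCLM (ContinuousLinearMap.proj i) (u i)

theorem Smooth.coe_prod {ι : Type*} (s : Finset ι) (f : ι → Smooth ℂ E) (x : E) :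
    ((∏ i ∈ s, f i : Smooth ℂ E) : E → ℂ) x = ∏ i ∈ s, (f i : E → ℂ) x := by
  rw [SubmonoidClass.coe_finsetProd, Finset.prod_apply]

theorem Smooth.piOuter_apply {n : ℕ} {E : Fin n → Type} [∀ i, NormedAddCommGroup (E i)]
    [∀ i, NormedSpace ℝ (E i)] (u : ∀ i, Smooth ℂ (E i)) (x : ∀ i, E i) :
    (Smooth.piOuter u : (∀ i, E i) → ℂ) x = ∏ i, (u i : E i → ℂ) (x i) := by
  rw [Smooth.piOuter, Smooth.coe_prod]
  rfl

/-- Tensor product of finitely many compactly supported distributions. -/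
theorem CompactDistribution.exists_piOuter {n : ℕ} {E : Fin n → Type}
    [∀ i, NormedAddCommGroup (E i)] [∀ i, NormedSpace ℝ (E i)]
    (T : ∀ i, CompactDistribution (E i)) :
    ∃ R : CompactDistribution (∀ i, E i), ∀ u,
      R.toLin (Smooth.piOuter u) = ∏ i, (T i).toLin (u i) := by
  induction n with
  | zero =>
    refine ⟨.dirac, fun u => ?_⟩
    change (Smooth.piOuter u : (∀ i, E i) → ℂ) 0 = _
    rw [Smooth.piOuter_apply]
    simp
  | succ n ih =>
    obtain ⟨R, hR⟩ := ih fun i => T i.succ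
    obtain ⟨R', hR'⟩ := (T 0).exists_outer R
    let A : (E 0 × ∀ i : Fin n, E i.succ) →L[ℝ] ∀ i, E i :=
      ContinuousLinearMap.pi (Fin.cases (ContinuousLinearMap.fst ℝ _ _)
        (fun i => (ContinuousLinearMap.proj (R := ℝ) (φ := fun i : Fin n => E i.succ) i).comp
          (ContinuousLinearMap.snd ℝ _ _)))
    refine ⟨R'.map A, fun u => ?_⟩
    rw [Fin.prod_univ_succ, ← hR fun i => u i.succ, ← hR', map_toLin]
    congr 1
    ext z
    rw [Smooth.compCLM_apply, Smooth.outer_apply, Smooth.piOuter_apply, Smooth.piOuter_apply,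
      Fin.prod_univ_succ]
    rfl

end Tensor

/-! ### Iterated derivatives of diagonals of multilinear maps -/

section MultilinearDerivatives

variable {ι S V : Type*} [DecidableEq ι] [AddCommGroup V] [Module ℝ V]

/-- Induction on the set of moving slots gives the Leibniz rule without any topology on `V`: along a
line the map is polynomial in t. -/
theorem hasDerivAt_multilinear_piecewise (L : MultilinearMap ℝ (fun _ : ι => V) ℂ)
    (s : Finset ι) (x y : ι → V) :
    HasDerivAt (fun t : ℝ => L (s.piecewise (x + t • y) x))
      (∑ i ∈ s, L (Function.update x i (y i))) 0 := by
  induction s using Finset.induction_on generalizing x with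
  | empty => simpa using hasDerivAt_const (0 : ℝ) (L x)
  | insert a s ha ih =>
    -- Linearity in slot a splits off a term with an explicit factor t, whose derivative at 0 is the
    -- cofactor at t = 0.
    have h1 : (fun t : ℝ => L ((insert a s).piecewise (x + t • y) x)) =
        fun t : ℝ => L (s.piecewise (x + t • y) x) +
          t • L (s.piecewise (Function.update x a (y a) + t • y) (Function.update x a (y a))) := by
      funext t
      rw [Finset.piecewise_insert, Pi.add_apply, Pi.smul_apply, L.map_update_add,
        L.map_update_smul]
      congr 3
      · funext i
        by_cases hi : i = a
        · subst hi; simp [ha]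
        · simp [hi]
      · funext i
        by_cases hi : i = a
        · subst hi; simp [ha]
        · by_cases his : i ∈ s <;> simp [hi, his]
    rw [h1, Finset.sum_insert ha]
    have h2 := (ih x).add ((hasDerivAt_id (0 : ℝ)).smul (ih (Function.update x a (y a))))
    have h3 : ∀ z : ι → V, s.piecewise z z = z := fun z => by
      funext i
      by_cases hi : i ∈ s <;> simp [hi]
    refine h2.congr_deriv ?_
    simp [add_comm, h3]

variable [Fintype ι]

theorem hasDerivAt_multilinear_line (L : MultilinearMap ℝ (fun _ : ι => V) ℂ) (x y : ι → V) :
    HasDerivAt (fun t : ℝ => L (x + t • y)) (∑ i, L (Function.update x i (y i))) 0 := by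
  simpa using hasDerivAt_multilinear_piecewise L Finset.univ x y

/-- Derivative of a multilinear map some of whose arguments are frozen, the others being equal. -/
theorem hasDerivAt_multilinear_partial (L : MultilinearMap ℝ (fun _ : ι => V) ℂ) (v : S → V)
    (a : ι → Option S) (φ : V) (w : S) :
    HasDerivAt (fun t : ℝ => L fun i => (a i).elim (φ + t • v w) v)
      ((((Finset.univ.filter fun i => a i = none).toList.map fun i =>
        Function.update a i (some w)).map fun b => L fun i => (b i).elim φ v).sum) 0 := by
  -- A frozen slot moves in direction 0, so its summand vanishes; only the open slots (`none`)
  -- contribute.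
  have h := hasDerivAt_multilinear_line L (fun i => (a i).elim φ v)
    (fun i => (a i).elim (v w) fun _ => 0)
  have h1 : (fun t : ℝ => L fun i => (a i).elim (φ + t • v w) v) = fun t : ℝ =>
      L ((fun i => (a i).elim φ v) + t • fun i => (a i).elim (v w) fun _ => 0) := by
    funext t
    congr 1
    funext i
    cases hi : a i <;> simp [hi]
  rw [h1]
  convert h using 1
  rw [List.map_map, Finset.sum_map_toList, Finset.sum_filter]
  refine Finset.sum_congr rfl fun i _ => ?_
  cases hi : a i with
  | none =>
    rw [if_pos rfl]
    simp only [Function.comp_apply, Option.elim_none]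
    congr 1
    funext j
    by_cases hj : j = i
    · subst hj; simp
    · simp [hj]
  | some w' =>
    rw [if_neg (by simp)]
    exact (L.map_coord_zero i (by simp)).symm

theorem hasDerivAt_multilinear_partial_sum (L : MultilinearMap ℝ (fun _ : ι => V) ℂ) (v : S → V)
    (As : List (ι → Option S)) (φ : V) (w : S) :
    HasDerivAt (fun t : ℝ => (As.map fun a => L fun i => (a i).elim (φ + t • v w) v).sum)
      (((As.flatMap fun a => (Finset.univ.filter fun i => a i = none).toList.map fun i =>
        Function.update a i (some w)).map fun b => L fun i => (b i).elim φ v).sum) 0 := by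
  induction As with
  | nil => simpa using hasDerivAt_const (0 : ℝ) (0 : ℂ)
  | cons a As ih =>
    simp only [List.map_cons, List.sum_cons, List.flatMap_cons, List.map_append,
      List.sum_append]
    exact (hasDerivAt_multilinear_partial L v a φ w).add ih

/-- The iterated directional derivatives of the diagonal of a multilinear map. -/
theorem exists_foldr_lineDeriv_eq (ws : List S) (hws : ws.Nodup) :
    ∃ As : List (ι → Option S),
      (∀ a ∈ As, (∀ w ∈ ws, ∃ i, a i = some w) ∧ (∀ i w, a i = some w → w ∈ ws) ∧
        ∀ i j w, a i = some w → a j = some w → i = j) ∧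
      ∀ (L : MultilinearMap ℝ (fun _ : ι => V) ℂ) (v : S → V),
        ws.foldr (fun w G φ => lineDeriv ℝ G φ (v w)) (fun φ => L fun _ => φ) =
          fun φ => (As.map fun a => L fun i => (a i).elim φ v).sum := by
  induction ws with
  | nil => exact ⟨[fun _ => none], by simp, by simp⟩
  | cons w ws ih =>
    rw [List.nodup_cons] at hws
    obtain ⟨As, hAs, h⟩ := ih hws.2
    -- Each further derivative puts the new direction `w` into one open slot, in all possible ways.
    refine ⟨As.flatMap fun a => (Finset.univ.filter fun i => a i = none).toList.map fun i =>
      Function.update a i (some w), ?_, fun L v => ?_⟩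
    · intro b hb
      simp only [List.mem_flatMap, List.mem_map, Finset.mem_toList, Finset.mem_filter,
        Finset.mem_univ, true_and] at hb
      obtain ⟨a, ha, i, hi, rfl⟩ := hb
      obtain ⟨h1, h2, h3⟩ := hAs a ha
      refine ⟨fun u hu => ?_, fun j u hj => ?_, fun j j' u hj hj' => ?_⟩
      · rcases List.mem_cons.1 hu with rfl | hu
        · exact ⟨i, by simp⟩
        · obtain ⟨j, hj⟩ := h1 u hu
          refine ⟨j, ?_⟩
          rw [Function.update_of_ne (by rintro rfl; simp [hi] at hj), hj]
      · by_cases hji : j = i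
        · subst hji
          simp only [Function.update_self, Option.some.injEq] at hj
          simp [hj]
        · rw [Function.update_of_ne hji] at hj
          exact List.mem_cons_of_mem _ (h2 j u hj)
      · by_cases hji : j = i
        · by_cases hji' : j' = i
          · rw [hji, hji']
          · rw [Function.update_of_ne hji'] at hj'
            subst hji
            simp only [Function.update_self, Option.some.injEq] at hj
            exact absurd (hj ▸ h2 j' u hj') hws.1
        · by_cases hji' : j' = i
          · rw [Function.update_of_ne hji] at hj
            subst hji'
            simp only [Function.update_self, Option.some.injEq] at hj'
            exact absurd (hj' ▸ h2 j u hj) hws.1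
          · rw [Function.update_of_ne hji] at hj
            rw [Function.update_of_ne hji'] at hj'
            exact h3 j j' u hj hj'
    · rw [List.foldr_cons, h L v]
      funext φ
      exact (hasDerivAt_multilinear_partial_sum L v As φ w).deriv

/-- `lineDeriv` takes the default value 0 where the derivative does not exist, so differentiating a
sum termwise requires this at every stage. -/
theorem lineDifferentiableAt_foldr_lineDeriv (ws : List S) (hws : ws.Nodup)
    (L : MultilinearMap ℝ (fun _ : ι => V) ℂ) (v : S → V) (φ : V) (w : S) :
    LineDifferentiableAt ℝ
      (ws.foldr (fun w G φ => lineDeriv ℝ G φ (v w)) (fun φ => L fun _ => φ)) φ (v w) := by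
  obtain ⟨As, -, h⟩ := exists_foldr_lineDeriv_eq (ι := ι) (V := V) ws hws
  rw [h L v]
  exact (hasDerivAt_multilinear_partial_sum L v As φ w).differentiableAt

/-- At the origin, the iterated directional derivative of the diagonal of a multilinear map is a
sum over assignments of the directions to the arguments. -/
theorem exists_foldr_lineDeriv_zero_eq (ws : List S) (hws : ws.Nodup) (hmem : ∀ w, w ∈ ws) :
    ∃ Es : List (S ≃ ι), ∀ (L : MultilinearMap ℝ (fun _ : ι => V) ℂ) (v : S → V),
      ws.foldr (fun w G φ => lineDeriv ℝ G φ (v w)) (fun φ => L fun _ => φ) 0 =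
        (Es.map fun e => L fun i => v (e.symm i)).sum := by
  obtain ⟨As, hAs, h⟩ := exists_foldr_lineDeriv_eq (ι := ι) (V := V) ws hws
  simp only [h]
  clear h
  induction As with
  | nil => exact ⟨[], by simp⟩
  | cons a As ih =>
    obtain ⟨Es, hEs⟩ := ih fun b hb => hAs b (List.mem_cons_of_mem _ hb)
    obtain ⟨h1, -, h3⟩ := hAs a List.mem_cons_self
    -- A slot still open is evaluated at φ = 0, which kills the term. If none is open, the
    -- assignment from slots to directions is a bijection.
    by_cases hn : ∃ i, a i = none
    · obtain ⟨i, hi⟩ := hn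
      refine ⟨Es, fun L v => ?_⟩
      rw [List.map_cons, List.sum_cons, hEs, L.map_coord_zero i (by simp [hi]), zero_add]
    · push Not at hn
      choose f hf using fun i => Option.ne_none_iff_exists'.1 (hn i)
      have hb : Function.Bijective f := by
        refine ⟨fun i j hij => h3 i j (f i) (hf i) (hij ▸ hf j), fun w => ?_⟩
        obtain ⟨i, hi⟩ := h1 w (hmem w)
        exact ⟨i, by rw [hf] at hi; exact Option.some.inj hi⟩
      refine ⟨(Equiv.ofBijective f hb).symm :: Es, fun L v => ?_⟩
      rw [List.map_cons, List.sum_cons, hEs, List.map_cons, List.sum_cons]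
      simp [hf]

/-- Iterated directional derivatives of a finite sum of diagonals of multilinear maps. -/
theorem foldr_lineDeriv_sum {C : Type*} (t : Finset C) {ι : C → Type*} [∀ c, Fintype (ι c)]
    (L : ∀ c, MultilinearMap ℝ (fun _ : ι c => V) ℂ) (v : S → V) (ws : List S)
    (hws : ws.Nodup) :
    ws.foldr (fun w G φ => lineDeriv ℝ G φ (v w)) (fun φ => ∑ c ∈ t, L c fun _ => φ) =
      fun φ => ∑ c ∈ t,
        ws.foldr (fun w G φ => lineDeriv ℝ G φ (v w)) (fun φ => L c fun _ => φ) φ := by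
  classical
  induction ws with
  | nil => rfl
  | cons w ws ih =>
    rw [List.nodup_cons] at hws
    rw [List.foldr_cons, ih hws.2]
    funext φ
    refine HasDerivAt.deriv ?_
    simp only [List.foldr_cons]
    exact HasDerivAt.fun_sum fun c _ =>
      (lineDifferentiableAt_foldr_lineDeriv ws hws.2 (L c) v φ w).hasDerivAt

end MultilinearDerivatives

/-! ### Functional derivatives as directional derivatives -/

section FunctionalDerivatives

variable {ι : Type} [Fintype ι]

theorem tensorFn_apply (h : ι → Config) (x : MPow ι) :
    (tensorFn h : MPow ι → ℂ) x = ∏ j, (((h j : M → ℝ) (x j) : ℝ) : ℂ) := rfl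

/-- The multilinear map `x ↦ ∏ i, x i (idx i) (z i)` on tuples of field configurations. -/
def tensorEval {κ : Type*} (idx : ι → κ) (z : MPow ι) :
    MultilinearMap ℝ (fun _ : ι => κ → Config) ℂ :=
  (MultilinearMap.mkPiAlgebra ℝ ι ℂ).compLinearMap fun i =>
    { toFun := fun c => (((c (idx i) : M → ℝ) (z i) : ℝ) : ℂ)
      map_add' := fun _ _ => Complex.ofReal_add _ _
      map_smul' := fun _ _ => Complex.ofReal_mul _ _ }

/-- The multilinear map `x ↦ Ψ(∏ i, x i (idx i))` on tuples of field configurations. -/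
def tensorMultilinear {κ : Type*} (Ψ : CompactDistribution (MPow ι)) (idx : ι → κ) :
    MultilinearMap ℝ (fun _ : ι => κ → Config) ℂ where
  toFun x := Ψ.toLin (tensorFn fun i => x i (idx i))
  map_update_add' := by
    intro _ x i a b
    rw [← map_add]
    congr 1
    ext z
    exact (tensorEval idx z).map_update_add x i a b
  map_update_smul' := by
    intro _ x i c a
    rw [← Complex.coe_smul, ← map_smul]
    congr 1
    ext z
    exact ((tensorEval idx z).map_update_smul x i c a)

/-- Flattening the pairs into one list of directions labelled by `Fin k ⊕ Fin k` makes the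
multilinear calculus applicable. -/
theorem iteratedFunDeriv_eq_foldr {n k : ℕ} (s r : Fin k → Fin (n + 1)) (h g : Fin k → Config)
    (G : (Fin (n + 1) → Config) → ℂ) :
    iteratedFunDeriv s r h g G =
      ((List.finRange k).flatMap fun l => [Sum.inl l, Sum.inr l]).foldr
        (fun (w : Fin k ⊕ Fin k) G φ =>
          lineDeriv ℝ G φ (Pi.single (Sum.elim s r w) (Sum.elim h g w))) G := by
  rw [iteratedFunDeriv]
  induction List.finRange k with
  | nil => rfl
  | cons l ls ih => 
    rw [List.foldr_cons, ih]
    rfl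

end FunctionalDerivatives

/-! ### Plane waves and polynomial growth of Fourier transforms -/

section PlaneWaves

open FourierTransform

variable {E : Type*} [NormedAddCommGroup E] [InnerProductSpace ℝ E]

theorem planeWave_apply (ξ x : E) :
    (planeWave ξ : E → ℂ) x = Complex.exp (-(Complex.I * ((inner ℝ ξ x : ℝ) : ℂ))) := rfl

theorem planeWave_add (ξ η : E) : planeWave (ξ + η) = planeWave ξ * planeWave η := by
  ext x
  change (planeWave (ξ + η) : E → ℂ) x = (planeWave ξ : E → ℂ) x * (planeWave η : E → ℂ) x
  rw [planeWave_apply, planeWave_apply, planeWave_apply, ← Complex.exp_add, inner_add_left]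
  push_cast
  ring_nf

theorem norm_planeWave (ξ x : E) : ‖(planeWave ξ : E → ℂ) x‖ = 1 := by
  rw [planeWave_apply, Complex.norm_exp]
  simp

theorem dirDeriv_planeWave (ξ v : E) :
    Smooth.dirDeriv v (planeWave ξ) =
      (-(Complex.I * ((inner ℝ ξ v : ℝ) : ℂ))) • planeWave ξ := by
  ext x
  have h1 : HasFDerivAt (fun x : E => ((inner ℝ ξ x : ℝ) : ℂ))
      (Complex.ofRealCLM.comp (innerSL ℝ ξ)) x :=
    (Complex.ofRealCLM.comp (innerSL ℝ ξ)).hasFDerivAt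
  have h2 : HasFDerivAt (planeWave ξ : E → ℂ) _ x := ((h1.const_mul Complex.I).neg).cexp
  change fderiv ℝ (planeWave ξ : E → ℂ) x v = _ * (planeWave ξ : E → ℂ) x
  rw [h2.fderiv]
  simp [planeWave_apply, mul_comm]

theorem iteratedFDeriv_planeWave (ξ x : E) {j : ℕ} (m : Fin j → E) :
    iteratedFDeriv ℝ j (planeWave ξ : E → ℂ) x m =
      (∏ i, (-(Complex.I * ((inner ℝ ξ (m i) : ℝ) : ℂ)))) * (planeWave ξ : E → ℂ) x := by
  induction j with
  | zero => simp
  | succ j ih =>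
    conv_lhs => rw [← Fin.snoc_init_self m, Smooth.iteratedFDeriv_snoc, dirDeriv_planeWave,
      Smooth.iteratedFDeriv_smul, smul_apply, ih]
    rw [Fin.prod_univ_castSucc, smul_eq_mul]
    simp only [Fin.init]
    ring

theorem norm_iteratedFDeriv_planeWave_le (ξ x : E) (j : ℕ) :
    ‖iteratedFDeriv ℝ j (planeWave ξ : E → ℂ) x‖ ≤ ‖ξ‖ ^ j := by
  refine ContinuousMultilinearMap.opNorm_le_bound (by positivity) fun m => ?_
  rw [iteratedFDeriv_planeWave, norm_mul, norm_planeWave, mul_one, norm_prod]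
  calc _ ≤ ∏ i, ‖ξ‖ * ‖m i‖ := by
        refine Finset.prod_le_prod (fun _ _ => norm_nonneg _) fun i _ => ?_
        simpa using norm_inner_le_norm (𝕜 := ℝ) ξ (m i)
    _ = _ := by simp [Finset.prod_mul_distrib]

theorem CompactDistribution.exists_norm_fourier_le (T : CompactDistribution E) :
    ∃ (N : ℕ) (C : ℝ), 0 ≤ C ∧ ∀ ξ, ‖fourier T ξ‖ ≤ C * (1 + ‖ξ‖) ^ N := by
  obtain ⟨K, hK, N, C, hC, h⟩ := T.exists_nonneg_bound
  refine ⟨N, C, hC, fun ξ => h _ _ (by positivity) fun j hj x _ =>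
    (norm_iteratedFDeriv_planeWave_le ξ x j).trans ?_⟩
  exact (pow_le_pow_left₀ (norm_nonneg _) (by linarith) j).trans
    (pow_le_pow_right₀ (by linarith [norm_nonneg ξ]) hj)

/-- The derivatives of `x ↦ g v * exp (- 2 π i ⟨v, x⟩)`. -/
theorem iteratedFDeriv_smul_planeWave (g : E → ℂ) (v x : E) (j : ℕ) :
    iteratedFDeriv ℝ j ((g v • planeWave ((2 * Real.pi) • v) : Smooth ℂ E) : E → ℂ) x =
      𝐞 (-inner ℝ v x) • VectorFourier.fourierPowSMulRight (innerSL ℝ) g v j := by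
  ext m
  rw [Smooth.iteratedFDeriv_smul, smul_apply, iteratedFDeriv_planeWave,
    planeWave_apply]
  have h : ∏ i, (-(Complex.I * ((inner ℝ ((2 * Real.pi) • v) (m i) : ℝ) : ℂ))) =
      (-(2 * Real.pi * Complex.I)) ^ j * ∏ i, ((inner ℝ v (m i) : ℝ) : ℂ) := by
    rw [← Fin.prod_const, ← Finset.prod_mul_distrib]
    refine Finset.prod_congr rfl fun i _ => ?_
    rw [real_inner_smul_left]
    push_cast
    ring
  have hsm : (𝐞 (-inner ℝ v x) • VectorFourier.fourierPowSMulRight (innerSL ℝ) g v j) m =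
      (𝐞 (-inner ℝ v x) : ℂ) • VectorFourier.fourierPowSMulRight (innerSL ℝ) g v j m := rfl
  rw [h, hsm, VectorFourier.fourierPowSMulRight_apply, Real.fourierChar_apply,
    real_inner_smul_left]
  have he : -(Complex.I * ((2 * Real.pi * inner ℝ v x : ℝ) : ℂ)) =
      ((2 * Real.pi * -inner ℝ v x : ℝ) : ℂ) * Complex.I := by
    push_cast
    ring
  have hi : ∏ i, ((innerSL ℝ v (m i) : ℝ) : ℂ) = ∏ i, ((inner ℝ v (m i) : ℝ) : ℂ) := rfl
  rw [he]
  simp only [smul_eq_mul, Complex.real_smul, Complex.ofReal_prod, hi]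
  ring

end PlaneWaves

/-! ### Distributions under the Fourier integral -/

section Convolution

open MeasureTheory FourierTransform SchwartzMap

variable {E : Type*} [NormedAddCommGroup E] [InnerProductSpace ℝ E] [FiniteDimensional ℝ E]
  [MeasurableSpace E] [BorelSpace E]

theorem integrable_one_add_norm_pow_mul (g : 𝓢(E, ℂ)) (N : ℕ) :
    Integrable (fun v => (1 + ‖v‖) ^ N * ‖g v‖) := by
  have h : (fun v => (1 + ‖v‖) ^ N * ‖g v‖) = fun v =>
      ∑ k ∈ Finset.range (N + 1), (N.choose k : ℝ) * (‖v‖ ^ k * ‖g v‖) := by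
    funext v
    rw [add_comm, add_pow, Finset.sum_mul]
    refine Finset.sum_congr rfl fun k _ => ?_
    rw [one_pow]
    ring
  rw [h]
  exact integrable_finsetSum _ fun k _ => (g.integrable_pow_mul volume k).const_mul _

/-- Evaluation of a component of a jet. -/
def JetSpace.eval {K : Set E} [CompactSpace K] {N : ℕ} (j : Fin (N + 1)) (x : K) :
    JetSpace K N →L[ℂ] (E [×j]→L[ℝ] ℂ) :=
  LinearMap.mkContinuous
    { toFun := fun F => F j x, map_add' := fun _ _ => rfl, map_smul' := fun _ _ => rfl } 1
    fun F => by
      rw [one_mul]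
      exact ((F j).norm_coe_le_norm x).trans
        (norm_le_pi_norm (f := (F : ∀ j : Fin (N + 1), C(K, E [×j]→L[ℝ] ℂ))) j)

/-- A compactly supported distribution commutes with the Fourier integral. -/
theorem CompactDistribution.toLin_eq_integral (u : CompactDistribution E) (ψ : Smooth ℂ E)
    (g : 𝓢(E, ℂ)) (h : (ψ : E → ℂ) = 𝓕 (g : E → ℂ)) :
    u.toLin ψ = ∫ v, g v * fourier u ((2 * Real.pi) • v) := by
  obtain ⟨K, hK, N, Φ, hΦ⟩ := u.exists_eq_dual_jet
  -- The Fourier integral of g becomes a Bochner integral in the Banach space of jets, through which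
  -- the continuous functional Φ passes.
  let w : E → JetSpace K N := fun v => jet K N (g v • planeWave ((2 * Real.pi) • v))
  have hcont : Continuous w := by
    have : Continuous (fun v => (w v : ∀ j : Fin (N + 1), C(K, E [×j]→L[ℝ] ℂ))) := by
      refine continuous_pi fun j => ContinuousMap.continuous_of_continuous_uncurry _ ?_
      have he : (Function.uncurry fun v (x : K) => w v j x) = fun p : E × K =>
          𝐞 (-inner ℝ p.1 (p.2 : E)) •
            VectorFourier.fourierPowSMulRight (innerSL ℝ) g p.1 j := by
        funext p
        exact iteratedFDeriv_smul_planeWave g p.1 p.2 j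
      refine Eq.mpr (congrArg Continuous he) ?_
      have hc := (g.continuous.fourierPowSMulRight (innerSL ℝ) j).comp
        (continuous_fst (X := E) (Y := K))
      refine Continuous.smul (f := fun p : E × K => 𝐞 (-inner ℝ p.1 (p.2 : E))) ?_ hc
      exact Real.continuous_fourierChar.comp
        (continuous_fst.inner (continuous_subtype_val.comp continuous_snd)).neg
    exact this
  have hbound : ∀ v, ‖w v‖ ≤ (2 * Real.pi) ^ N * ((1 + ‖v‖) ^ N * ‖g v‖) := by
    intro v
    refine norm_jet_le _ (by positivity) fun j hj x _ => ?_
    rw [Smooth.iteratedFDeriv_smul, norm_smul, ← mul_assoc, mul_comm, ← mul_pow]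
    refine mul_le_mul_of_nonneg_right ?_ (norm_nonneg _)
    refine (norm_iteratedFDeriv_planeWave_le _ _ _).trans ?_
    have h1 : (1 : ℝ) ≤ 2 * Real.pi := by linarith [Real.pi_gt_three]
    have h2 : (1 : ℝ) ≤ 2 * Real.pi * (1 + ‖v‖) := by nlinarith [norm_nonneg v]
    refine le_trans (pow_le_pow_left₀ (norm_nonneg _) ?_ j) (pow_le_pow_right₀ h2 hj)
    rw [norm_smul, Real.norm_of_nonneg (by positivity)]
    nlinarith
  have hint : Integrable w := ((integrable_one_add_norm_pow_mul g N).const_mul _).mono'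
    hcont.aestronglyMeasurable (Filter.Eventually.of_forall hbound)
  have hjet : jet K N ψ = ∫ v, w v := by
    funext j
    apply ContinuousMap.ext
    intro x
    have h1 := (JetSpace.eval (N := N) j x).integral_comp_comm hint
    refine Eq.trans ?_ h1
    change iteratedFDeriv ℝ j (ψ : E → ℂ) x =
      ∫ v, iteratedFDeriv ℝ j ((g v • planeWave ((2 * Real.pi) • v) : Smooth ℂ E) : E → ℂ) x
    rw [h, Real.iteratedFDeriv_fourier (N := ⊤) (fun n _ => g.integrable_pow_mul volume n)
      g.continuous.aestronglyMeasurable le_top, Real.fourier_eq]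
    refine integral_congr_ae (Filter.Eventually.of_forall fun v => ?_)
    exact (iteratedFDeriv_smul_planeWave g v x j).symm
  rw [← hΦ, hjet, ← Φ.integral_comp_comm hint]
  refine integral_congr_ae (Filter.Eventually.of_forall fun v => ?_)
  change Φ (jet K N _) = _
  rw [hΦ, map_smul]
  rfl

/-- This is the convolution formula for the Fourier transform of a product, obtained by absorbing
the plane wave into the distribution. -/
theorem CompactDistribution.toLin_mul_planeWave_eq_integral (u : CompactDistribution E)
    (ψ : Smooth ℂ E) (g : 𝓢(E, ℂ)) (h : (ψ : E → ℂ) = 𝓕 (g : E → ℂ)) (ξ : E) :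
    u.toLin (ψ * planeWave ξ) = ∫ v, g v * fourier u (ξ + (2 * Real.pi) • v) := by
  rw [mul_comm]
  refine ((u.smul (planeWave ξ)).toLin_eq_integral ψ g h).trans ?_
  simp only [fourier, planeWave_add]
  rfl

end Convolution

/-! ### Rapid decrease on cones -/

section RapidDecrease

variable {E : Type*} [NormedAddCommGroup E]

theorem RapidlyDecreasingOn.exists_nonneg {f : E → ℂ} {S : Set E} (h : RapidlyDecreasingOn f S)
    (N : ℕ) : ∃ C : ℝ, 0 ≤ C ∧ ∀ p ∈ S, (1 + ‖p‖) ^ N * ‖f p‖ ≤ C := by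
  obtain ⟨C, hC⟩ := h N
  exact ⟨max C 0, le_max_right _ _, fun p hp => (hC p hp).trans (le_max_left _ _)⟩

theorem RapidlyDecreasingOn.add {f g : E → ℂ} {S : Set E} (hf : RapidlyDecreasingOn f S)
    (hg : RapidlyDecreasingOn g S) : RapidlyDecreasingOn (fun p => f p + g p) S := by
  intro N
  obtain ⟨C, hC⟩ := hf N
  obtain ⟨D, hD⟩ := hg N
  refine ⟨C + D, fun p hp => ?_⟩
  have h1 := mul_le_mul_of_nonneg_left (norm_add_le (f p) (g p))
    (by positivity : 0 ≤ (1 + ‖p‖) ^ N)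
  linarith [hC p hp, hD p hp]

theorem RapidlyDecreasingOn.mono {f : E → ℂ} {S S' : Set E} (hf : RapidlyDecreasingOn f S)
    (h : S' ⊆ S) : RapidlyDecreasingOn f S' := fun N =>
  let ⟨C, hC⟩ := hf N
  ⟨C, fun p hp => hC p (h hp)⟩

theorem RapidlyDecreasingOn.union {f : E → ℂ} {S S' : Set E} (h : RapidlyDecreasingOn f S)
    (h' : RapidlyDecreasingOn f S') : RapidlyDecreasingOn f (S ∪ S') := by
  intro N
  obtain ⟨C, hC⟩ := h N
  obtain ⟨D, hD⟩ := h' N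
  exact ⟨max C D, fun p hp => hp.elim (fun hp => (hC p hp).trans (le_max_left _ _))
    fun hp => (hD p hp).trans (le_max_right _ _)⟩

/-- Peetre's inequality. -/
theorem one_add_norm_le_mul (ξ η : E) : 1 + ‖ξ‖ ≤ (1 + ‖ξ + η‖) * (1 + ‖η‖) := by
  have h := norm_sub_le (ξ + η) η
  rw [add_sub_cancel_right] at h
  nlinarith [norm_nonneg (ξ + η), norm_nonneg η]

/-- A polynomially bounded function that decreases rapidly on `Γ` decreases rapidly on a smaller
cone, uniformly up to polynomial factors in the size of translations. -/
theorem translation_bound {f : E → ℂ} {Γ Γ' : Set E} {c : ℝ} (hc : 0 < c) (hc1 : c ≤ 1)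
    (hΓ : ∀ ξ ∈ Γ', ∀ η, ‖η‖ ≤ c * ‖ξ‖ → ξ + η ∈ Γ) (hf : RapidlyDecreasingOn f Γ) {N₀ : ℕ}
    {C₀ : ℝ} (hC₀ : 0 ≤ C₀) (hf₀ : ∀ ξ, ‖f ξ‖ ≤ C₀ * (1 + ‖ξ‖) ^ N₀) (N : ℕ) :
    ∃ (L : ℕ) (C : ℝ), ∀ ξ ∈ Γ', ∀ η, (1 + ‖ξ‖) ^ N * ‖f (ξ + η)‖ ≤ C * (1 + ‖η‖) ^ L := by
  obtain ⟨C, hC, h⟩ := hf.exists_nonneg N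
  refine ⟨N + N₀ + N₀, C + C₀ / c ^ (N + N₀), fun ξ hξ η => ?_⟩
  have hη : 1 ≤ 1 + ‖η‖ := by linarith [norm_nonneg η]
  rw [add_mul]
  -- For small η the point ξ + η stays in Γ, and Peetre's inequality transfers the decay. For large
  -- η, 1 + ‖ξ‖ ≤ (1 + ‖η‖) / c, so powers of ‖η‖ absorb everything.
  by_cases hs : ‖η‖ ≤ c * ‖ξ‖
  · have h1 := h _ (hΓ ξ hξ η hs)
    calc (1 + ‖ξ‖) ^ N * ‖f (ξ + η)‖
        ≤ ((1 + ‖ξ + η‖) * (1 + ‖η‖)) ^ N * ‖f (ξ + η)‖ := by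
          gcongr
          exact one_add_norm_le_mul ξ η
      _ = ((1 + ‖ξ + η‖) ^ N * ‖f (ξ + η)‖) * (1 + ‖η‖) ^ N := by rw [mul_pow]; ring
      _ ≤ C * (1 + ‖η‖) ^ (N + N₀ + N₀) := by
          gcongr
          omega
      _ ≤ _ := le_add_of_nonneg_right (by positivity)
  · push Not at hs
    have h1 : 1 + ‖ξ‖ ≤ (1 + ‖η‖) / c := by
      rw [le_div_iff₀ hc]
      linarith
    have h2 : 1 + ‖ξ + η‖ ≤ (1 + ‖ξ‖) * (1 + ‖η‖) := by
      nlinarith [norm_add_le ξ η, norm_nonneg ξ, norm_nonneg η]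
    calc (1 + ‖ξ‖) ^ N * ‖f (ξ + η)‖
        ≤ (1 + ‖ξ‖) ^ N * (C₀ * ((1 + ‖ξ‖) * (1 + ‖η‖)) ^ N₀) := by
          gcongr
          exact (hf₀ _).trans (by gcongr)
      _ = C₀ * (1 + ‖ξ‖) ^ (N + N₀) * (1 + ‖η‖) ^ N₀ := by rw [mul_pow, pow_add]; ring
      _ ≤ C₀ * ((1 + ‖η‖) / c) ^ (N + N₀) * (1 + ‖η‖) ^ N₀ := by gcongr
      _ = C₀ / c ^ (N + N₀) * (1 + ‖η‖) ^ (N + N₀ + N₀) := by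
          rw [div_pow, pow_add (1 + ‖η‖) (N + N₀) N₀]; ring
      _ ≤ _ := le_add_of_nonneg_left (by positivity)

variable [NormedSpace ℝ E]

/-- `f` is rapidly decreasing on an open conic neighbourhood of `ξ₀`. -/
def RapidNear (f : E → ℂ) (ξ₀ : E) : Prop :=
  ∃ Γ : Set E, IsOpen Γ ∧ IsConic Γ ∧ ξ₀ ∈ Γ ∧ RapidlyDecreasingOn f Γ

theorem IsConic.inter {Γ Γ' : Set E} (h : IsConic Γ) (h' : IsConic Γ') : IsConic (Γ ∩ Γ') :=
  fun p hp t ht => ⟨h p hp.1 t ht, h' p hp.2 t ht⟩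

theorem RapidNear.zero (ξ₀ : E) : RapidNear (fun _ => 0) ξ₀ :=
  ⟨Set.univ, isOpen_univ, fun _ _ _ _ => trivial, trivial, fun _ => ⟨0, by simp⟩⟩

theorem RapidNear.add {f g : E → ℂ} {ξ₀ : E} (hf : RapidNear f ξ₀) (hg : RapidNear g ξ₀) :
    RapidNear (fun p => f p + g p) ξ₀ := by
  obtain ⟨Γ, h1, h2, h3, h4⟩ := hf
  obtain ⟨Γ', h1', h2', h3', h4'⟩ := hg
  exact ⟨Γ ∩ Γ', h1.inter h1', h2.inter h2', ⟨h3, h3'⟩,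
    (h4.mono Set.inter_subset_left).add (h4'.mono Set.inter_subset_right)⟩

theorem RapidNear.finset_sum {ι : Type*} (s : Finset ι) {f : ι → E → ℂ} {ξ₀ : E}
    (h : ∀ i ∈ s, RapidNear (f i) ξ₀) : RapidNear (fun p => ∑ i ∈ s, f i p) ξ₀ := by
  classical
  induction s using Finset.induction_on with
  | empty => simpa using RapidNear.zero ξ₀
  | insert a s ha ih =>
    simp only [Finset.sum_insert ha]
    exact (h a (Finset.mem_insert_self _ _)).add
      (ih fun i hi => h i (Finset.mem_insert_of_mem hi))

theorem RapidNear.list_sum {ι : Type*} (s : List ι) {f : ι → E → ℂ} {ξ₀ : E}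
    (h : ∀ i ∈ s, RapidNear (f i) ξ₀) : RapidNear (fun p => (s.map fun i => f i p).sum) ξ₀ := by
  induction s with
  | nil => simpa using RapidNear.zero ξ₀
  | cons a s ih =>
    simp only [List.map_cons, List.sum_cons]
    exact (h a List.mem_cons_self).add (ih fun i hi => h i (List.mem_cons_of_mem _ hi))

/-- An open cone contains a uniform conic neighbourhood of each of its points. -/
theorem IsConic.exists_shrink {Γ : Set E} (hΓ : IsConic Γ) (ho : IsOpen Γ) {ξ₀ : E}
    (hξ₀ : ξ₀ ∈ Γ) : ∃ (Γ' : Set E) (c : ℝ), IsOpen Γ' ∧ IsConic Γ' ∧ ξ₀ ∈ Γ' ∧ 0 < c ∧ c ≤ 1 ∧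
      ∀ ξ ∈ Γ', ∀ η, ‖η‖ ≤ c * ‖ξ‖ → ξ + η ∈ Γ := by
  obtain ⟨δ, hδ, hball⟩ := Metric.isOpen_iff.1 ho ξ₀ hξ₀
  have hr : (0 : ℝ) < ‖ξ₀‖ + δ / 2 := by positivity
  -- Γ' is the union of the dilates of the ball of radius δ/2. In the dilate by t, ‖ξ‖ ≤ t(‖ξ₀‖ +
  -- δ/2), so this c gives ‖η‖ ≤ tδ/2, and ξ + η stays in the dilate of the δ-ball.
  refine ⟨⋃ t : {t : ℝ // 0 < t}, Metric.ball ((t : ℝ) • ξ₀) (t * (δ / 2)),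
    (δ / 2) / (‖ξ₀‖ + δ / 2), isOpen_iUnion fun _ => Metric.isOpen_ball, ?_, ?_, by positivity,
    ?_, ?_⟩
  · intro p hp a ha
    obtain ⟨⟨t, ht⟩, hp⟩ := Set.mem_iUnion.1 hp
    refine Set.mem_iUnion.2 ⟨⟨a * t, mul_pos ha ht⟩, ?_⟩
    rw [mem_ball_iff_norm] at hp ⊢
    have : a • p - (a * t) • ξ₀ = a • (p - t • ξ₀) := by rw [smul_sub, smul_smul]
    rw [this, norm_smul, Real.norm_of_nonneg ha.le, mul_assoc]
    exact mul_lt_mul_of_pos_left hp ha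
  · refine Set.mem_iUnion.2 ⟨⟨1, one_pos⟩, ?_⟩
    simp [hδ]
  · rw [div_le_one hr]
    linarith [norm_nonneg ξ₀]
  · intro ξ hξ η hη
    obtain ⟨⟨t, ht⟩, hξ⟩ := Set.mem_iUnion.1 hξ
    rw [mem_ball_iff_norm] at hξ
    have h1 : ‖ξ‖ ≤ t * (‖ξ₀‖ + δ / 2) := by
      have h2 := norm_add_le (ξ - t • ξ₀) (t • ξ₀)
      rw [sub_add_cancel, norm_smul, Real.norm_of_nonneg ht.le] at h2
      simp only at hξ
      linarith
    have h3 : ‖η‖ ≤ t * (δ / 2) := by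
      refine hη.trans ?_
      rw [div_mul_eq_mul_div, div_le_iff₀ hr]
      nlinarith
    have h4 : t⁻¹ • (ξ + η) ∈ Γ := by
      refine hball ?_
      rw [mem_ball_iff_norm]
      have h5 : t⁻¹ • (ξ + η) - ξ₀ = t⁻¹ • ((ξ - t • ξ₀) + η) := by
        rw [smul_add, smul_add, smul_sub, smul_smul, inv_mul_cancel₀ ht.ne', one_smul]
        abel
      rw [h5, norm_smul, norm_inv, Real.norm_of_nonneg ht.le, inv_mul_lt_iff₀ ht]
      have h6 := norm_add_le (ξ - t • ξ₀) η
      simp only at hξ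
      linarith
    have h7 := hΓ _ h4 t ht
    rwa [smul_smul, mul_inv_cancel₀ ht.ne', one_smul] at h7

end RapidDecrease

/-! ### From the wave front set to the global Fourier transform -/

section Localization

open MeasureTheory FourierTransform SchwartzMap

variable {E : Type*} [NormedAddCommGroup E] [InnerProductSpace ℝ E] [FiniteDimensional ℝ E]

/-- Multiplication by a compactly supported smooth function preserves rapid decrease of the
Fourier transform near a given direction. -/
theorem CompactDistribution.rapidNear_mul (u : CompactDistribution E) (ψ : Smooth ℂ E)
    (hψ : HasCompactSupport (ψ : E → ℂ)) {ξ₀ : E} (h : RapidNear (fourier u) ξ₀) :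
    RapidNear (fun ξ => u.toLin (ψ * planeWave ξ)) ξ₀ := by
  let _ : MeasurableSpace E := borel E
  have : BorelSpace E := ⟨rfl⟩
  obtain ⟨Γ, h1, h2, h3, h4⟩ := h
  obtain ⟨Γ', c, h1', h2', h3', hc, hc1, hs⟩ := h2.exists_shrink h1 h3
  refine ⟨Γ', h1', h2', h3', fun N => ?_⟩
  obtain ⟨N₀, C₀, hC₀, hf₀⟩ := u.exists_norm_fourier_le
  obtain ⟨L, C, hC⟩ := translation_bound hc hc1 hs h4 hC₀ hf₀ N
  let ψS : 𝓢(E, ℂ) := hψ.toSchwartzMap (Smooth.contDiff ψ)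
  let g : 𝓢(E, ℂ) := 𝓕⁻ ψS
  have hg : (ψ : E → ℂ) = 𝓕 (g : E → ℂ) := by
    rw [← SchwartzMap.fourier_coe]
    have : 𝓕 g = ψS := FourierTransform.fourier_fourierInv_eq ψS
    rw [this]
    rfl
  -- The translation bound is integrated against |g|, with η = 2πv and 1 + ‖2πv‖ ≤ 2π(1 + ‖v‖).
  refine ⟨∫ v, C * (2 * Real.pi) ^ L * ((1 + ‖v‖) ^ L * ‖g v‖), fun ξ hξ => ?_⟩
  beta_reduce
  rw [u.toLin_mul_planeWave_eq_integral ψ g hg ξ,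
    ← Real.norm_of_nonneg (by positivity : 0 ≤ (1 + ‖ξ‖) ^ N), ← norm_smul, ← integral_smul]
  refine norm_integral_le_of_norm_le ((integrable_one_add_norm_pow_mul g L).const_mul _)
    (Filter.Eventually.of_forall fun v => ?_)
  have h5 := hC ξ hξ ((2 * Real.pi) • v)
  have hC' : 0 ≤ C := by
    have := hC ξ hξ 0
    simp only [norm_zero, add_zero, one_pow, mul_one] at this
    exact le_trans (by positivity) this
  rw [norm_smul, norm_mul, Real.norm_of_nonneg (by positivity)]
  have h6 : 1 + ‖(2 * Real.pi) • v‖ ≤ 2 * Real.pi * (1 + ‖v‖) := by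
    rw [norm_smul, Real.norm_of_nonneg (by positivity)]
    linarith [Real.pi_gt_three]
  calc (1 + ‖ξ‖) ^ N * (‖g v‖ * ‖fourier u (ξ + (2 * Real.pi) • v)‖)
      = ‖g v‖ * ((1 + ‖ξ‖) ^ N * ‖fourier u (ξ + (2 * Real.pi) • v)‖) := by ring
    _ ≤ ‖g v‖ * (C * (2 * Real.pi * (1 + ‖v‖)) ^ L) := by
        refine mul_le_mul_of_nonneg_left (h5.trans ?_) (norm_nonneg _)
        gcongr
    _ = _ := by rw [mul_pow]; ring

/-- If no covector over `supp T` in the direction `ξ₀` belongs to the wave front set, then the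
Fourier transform of `T` is rapidly decreasing near `ξ₀`. -/
theorem CompactDistribution.rapidNear_fourier (T : CompactDistribution E) {ξ₀ : E}
    (hξ₀ : ξ₀ ≠ 0) (h : ∀ x, (x, ξ₀) ∉ waveFrontSet T) : RapidNear (fourier T) ξ₀ := by
  have h' : ∀ x, ∃ χ : Smooth ℂ E, HasCompactSupport (χ : E → ℂ) ∧ (χ : E → ℂ) x ≠ 0 ∧
      RapidNear (fourier (T.smul χ)) ξ₀ := by
    intro x
    by_contra hx
    exact h x ⟨hξ₀, hx⟩
  choose χ hcs hne hrap using h'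
  obtain ⟨K, hK, hcongr⟩ := T.exists_isCompact_congr
  obtain ⟨t, -, ht⟩ := hK.elim_nhds_subcover (fun x => {y | (χ x : E → ℂ) y ≠ 0}) fun x _ =>
    (isOpen_ne_fun (Smooth.contDiff (χ x)).continuous continuous_const).mem_nhds (hne x)
  let σ : E → ℝ := fun y => ∑ x ∈ t, ‖(χ x : E → ℂ) y‖ ^ 2
  have hσ : ContDiff ℝ ∞ σ := ContDiff.sum fun x _ => (Smooth.contDiff (χ x)).norm_sq ℝ
  obtain ⟨c, hc, hKc⟩ := hK.exists_forall_le' hσ.continuous.continuousOn (a := 0) (by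
    intro y hy
    obtain ⟨x, hx, hxy⟩ := Set.mem_iUnion₂.1 (ht hy)
    exact Finset.sum_pos' (fun _ _ => by positivity)
      ⟨x, hx, by have : 0 < ‖(χ x : E → ℂ) y‖ := norm_pos_iff.2 hxy
                 positivity⟩)
  -- The numerator is 0 where σ ≤ c/4 and 1 where σ ≥ c/2. Thus ρ is smooth despite the zeros of σ,
  -- and ρσ = 1 near K, where σ ≥ c.
  let ρ : E → ℝ := fun y => Real.smoothTransition (4 * σ y / c - 1) / σ y
  have hρ : ContDiff ℝ ∞ ρ := by
    rw [contDiff_iff_contDiffAt]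
    intro y
    have hnum : ContDiff ℝ ∞ fun y => Real.smoothTransition (4 * σ y / c - 1) :=
      Real.smoothTransition.contDiff.comp
        (((contDiff_const.mul hσ).div_const c).sub contDiff_const)
    by_cases hy : σ y = 0
    · have hlt : ∀ᶠ z in nhds y, σ z < c / 4 :=
        hσ.continuous.continuousAt.eventually_lt_const (by rw [hy]; positivity)
      refine (contDiffAt_const (c := (0 : ℝ))).congr_of_eventuallyEq ?_
      filter_upwards [hlt] with z hz
      have : 4 * σ z / c - 1 ≤ 0 := by
        rw [sub_nonpos, div_le_one hc]
        linarith
      simp [ρ, Real.smoothTransition.zero_of_nonpos this]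
    · exact hnum.contDiffAt.div hσ.contDiffAt hy
  -- The conjugate makes Σ χ_x ψ_x = ρ Σ |χ_x|² = ρσ, which is 1 near K.
  let ψ : E → Smooth ℂ E := fun x =>
    ⟨fun y => (starRingEnd ℂ) ((χ x : E → ℂ) y) * ((ρ y : ℝ) : ℂ),
      (Complex.conjCLE.contDiff.comp (Smooth.contDiff (χ x))).mul
        (Complex.ofRealCLM.contDiff.comp hρ)⟩
  have hψ : ∀ x, HasCompactSupport (ψ x : E → ℂ) := by
    intro x
    refine (hcs x).mono fun y hy => ?_
    simp only [Function.mem_support] at hy ⊢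
    intro h0
    apply hy
    change (starRingEnd ℂ) ((χ x : E → ℂ) y) * _ = 0
    rw [h0]
    simp
  have hsum : ∀ ξ, fourier T ξ = ∑ x ∈ t, (T.smul (χ x)).toLin (ψ x * planeWave ξ) := by
    intro ξ
    simp only [smul_toLin]
    rw [← map_sum]
    refine hcongr _ _ fun y hy => ?_
    have hgt : ∀ᶠ z in nhds y, c / 2 < σ z :=
      hσ.continuous.continuousAt.eventually_const_lt (by linarith [hKc y hy])
    filter_upwards [hgt] with z hz
    have h1 : 1 ≤ 4 * σ z / c - 1 := by
      rw [le_sub_iff_add_le, le_div_iff₀ hc]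
      linarith
    have h2 : σ z ≠ 0 := by linarith
    have h3 : ρ z * σ z = 1 := by
      simp only [ρ]
      rw [Real.smoothTransition.one_of_one_le h1, div_mul_cancel₀ _ h2]
    rw [AddSubmonoidClass.coe_finsetSum, Finset.sum_apply]
    have h4 : ∀ x, ((χ x * (ψ x * planeWave ξ) : Smooth ℂ E) : E → ℂ) z =
        ((‖(χ x : E → ℂ) z‖ ^ 2 : ℝ) : ℂ) * ((ρ z : ℂ) * (planeWave ξ : E → ℂ) z) := by
      intro x
      change (χ x : E → ℂ) z * (((starRingEnd ℂ) ((χ x : E → ℂ) z) * (ρ z : ℂ)) * _) = _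
      rw [← mul_assoc, ← mul_assoc, Complex.mul_conj, Complex.normSq_eq_norm_sq, mul_assoc]
    simp only [h4]
    rw [← Finset.sum_mul, ← Complex.ofReal_sum, ← mul_assoc, ← Complex.ofReal_mul,
      mul_comm (∑ x ∈ t, _), h3]
    simp
  have hfin : fourier T = fun ξ => ∑ x ∈ t, (T.smul (χ x)).toLin (ψ x * planeWave ξ) :=
    funext hsum
  rw [hfin]
  exact RapidNear.finset_sum t fun x _ => (T.smul (χ x)).rapidNear_mul (ψ x) (hψ x) (hrap x)

end Localization

/-! ### Polynomial bounds, linear substitutions and compactness of directions -/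

section PolynomialGrowth

variable {E F : Type*} [NormedAddCommGroup E] [NormedAddCommGroup F]

/-- `f` is bounded by a polynomial. -/
def PolynomiallyBounded (f : E → ℂ) : Prop :=
  ∃ (N : ℕ) (C : ℝ), 0 ≤ C ∧ ∀ p, ‖f p‖ ≤ C * (1 + ‖p‖) ^ N

theorem PolynomiallyBounded.mul {f g : E → ℂ} (hf : PolynomiallyBounded f)
    (hg : PolynomiallyBounded g) : PolynomiallyBounded fun p => f p * g p := by
  obtain ⟨N, C, hC, hf⟩ := hf
  obtain ⟨L, D, hD, hg⟩ := hg
  refine ⟨N + L, C * D, by positivity, fun p => ?_⟩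
  rw [norm_mul, pow_add]
  calc ‖f p‖ * ‖g p‖ ≤ (C * (1 + ‖p‖) ^ N) * (D * (1 + ‖p‖) ^ L) := by
        gcongr
        · exact hf p
        · exact hg p
    _ = _ := by ring

theorem PolynomiallyBounded.finset_prod {ι : Type*} (s : Finset ι) {f : ι → E → ℂ}
    (h : ∀ i ∈ s, PolynomiallyBounded (f i)) : PolynomiallyBounded fun p => ∏ i ∈ s, f i p := by
  classical
  induction s using Finset.induction_on with
  | empty => exact ⟨0, 1, zero_le_one, by simp⟩
  | insert a s ha ih =>
    simp only [Finset.prod_insert ha]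
    exact (h a (Finset.mem_insert_self _ _)).mul
      (ih fun i hi => h i (Finset.mem_insert_of_mem hi))

variable [NormedSpace ℝ E] [NormedSpace ℝ F]

theorem PolynomiallyBounded.comp_clm {f : F → ℂ} (hf : PolynomiallyBounded f) (A : E →L[ℝ] F) :
    PolynomiallyBounded fun p => f (A p) := by
  obtain ⟨N, C, hC, hf⟩ := hf
  refine ⟨N, C * (1 + ‖A‖) ^ N, by positivity, fun p => (hf _).trans ?_⟩
  rw [mul_assoc, ← mul_pow]
  gcongr
  nlinarith [A.le_opNorm p, norm_nonneg A, norm_nonneg p]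

theorem RapidNear.mul {f g : E → ℂ} {p₀ : E} (hf : RapidNear f p₀) (hg : PolynomiallyBounded g) :
    RapidNear (fun p => f p * g p) p₀ := by
  obtain ⟨Γ, h1, h2, h3, h4⟩ := hf
  obtain ⟨L, D, hD, hg⟩ := hg
  refine ⟨Γ, h1, h2, h3, fun N => ?_⟩
  obtain ⟨C, hC⟩ := h4 (N + L)
  refine ⟨C * D, fun p hp => ?_⟩
  rw [norm_mul]
  calc (1 + ‖p‖) ^ N * (‖f p‖ * ‖g p‖)
      ≤ (1 + ‖p‖) ^ N * (‖f p‖ * (D * (1 + ‖p‖) ^ L)) := by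
        gcongr
        exact hg p
    _ = ((1 + ‖p‖) ^ (N + L) * ‖f p‖) * D := by ring
    _ ≤ C * D := by
        gcongr
        exact hC p hp

/-- Where `A p₀ ≠ 0`, ‖p‖ is bounded by a multiple of ‖A p‖ on a conic neighbourhood, so decay in A
p is decay in p. -/
theorem RapidNear.comp_clm {f : F → ℂ} (A : E →L[ℝ] F) {p₀ : E} (hf : RapidNear f (A p₀))
    (h0 : A p₀ ≠ 0) : RapidNear (fun p => f (A p)) p₀ := by
  obtain ⟨Γ, h1, h2, h3, h4⟩ := hf
  have hp₀ : 0 < ‖A p₀‖ := norm_pos_iff.2 h0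
  -- The extra 1 makes the inequality strict at p₀, hence open, and also ensures c ≥ 1.
  set c : ℝ := ‖p₀‖ / ‖A p₀‖ + 1 with hc
  have hc1 : 1 ≤ c := by
    rw [hc]
    have : 0 ≤ ‖p₀‖ / ‖A p₀‖ := by positivity
    linarith
  refine ⟨A ⁻¹' Γ ∩ {p | ‖p‖ < c * ‖A p‖}, (h1.preimage A.continuous).inter
    (isOpen_lt continuous_norm (continuous_const.mul A.continuous.norm)), ?_, ⟨h3, ?_⟩, ?_⟩
  · intro p hp t ht
    refine ⟨?_, ?_⟩
    · change A (t • p) ∈ Γ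
      rw [map_smul]
      exact h2 _ hp.1 t ht
    · change ‖t • p‖ < c * ‖A (t • p)‖
      rw [map_smul, norm_smul, norm_smul, mul_left_comm]
      exact mul_lt_mul_of_pos_left hp.2 (norm_pos_iff.2 ht.ne')
  · change ‖p₀‖ < c * ‖A p₀‖
    rw [hc, add_mul, div_mul_cancel₀ _ hp₀.ne']
    linarith
  · intro N
    obtain ⟨C, hC⟩ := h4 N
    refine ⟨c ^ N * C, fun p hp => ?_⟩
    have h5 : 1 + ‖p‖ ≤ c * (1 + ‖A p‖) := by
      have : ‖p‖ < c * ‖A p‖ := hp.2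
      linarith
    calc (1 + ‖p‖) ^ N * ‖f (A p)‖ ≤ (c * (1 + ‖A p‖)) ^ N * ‖f (A p)‖ := by gcongr
      _ = c ^ N * ((1 + ‖A p‖) ^ N * ‖f (A p)‖) := by rw [mul_pow]; ring
      _ ≤ _ := by
        gcongr
        exact hC _ hp.1

/-- A polynomially bounded function that is rapidly decreasing near every direction of a closed
cone is rapidly decreasing in a neighbourhood of the cone. -/
theorem exists_isOpen_rapidlyDecreasingOn [FiniteDimensional ℝ E] {S : Set E} (hS : IsClosed S)
    (hcone : IsConic S) {f : E → ℂ} (hf : PolynomiallyBounded f)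
    (h : ∀ p ∈ S, p ≠ 0 → RapidNear f p) :
    ∃ U Γ : Set E, IsOpen U ∧ S ⊆ U ∧ IsOpen Γ ∧ IsConic Γ ∧ S \ {0} ⊆ Γ ∧ Γ ⊆ U ∧
      RapidlyDecreasingOn f U := by
  have hcpt : IsCompact (Metric.sphere (0 : E) 1 ∩ S) := (isCompact_sphere _ _).inter_right hS
  obtain ⟨Γ, hΓ, hΓc, hsub, hrd⟩ : ∃ Γ : Set E, IsOpen Γ ∧ IsConic Γ ∧
      Metric.sphere (0 : E) 1 ∩ S ⊆ Γ ∧ RapidlyDecreasingOn f Γ := by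
    refine hcpt.induction_on (p := fun s => ∃ Γ : Set E, IsOpen Γ ∧ IsConic Γ ∧
      s ⊆ Γ ∧ RapidlyDecreasingOn f Γ) ?_ ?_ ?_ ?_
    · exact ⟨∅, isOpen_empty, fun _ h => h.elim, subset_rfl, fun _ => ⟨0, fun _ h => h.elim⟩⟩
    · rintro s t hst ⟨Γ, h1, h2, h3, h4⟩
      exact ⟨Γ, h1, h2, hst.trans h3, h4⟩
    · rintro s t ⟨Γ, h1, h2, h3, h4⟩ ⟨Γ', h1', h2', h3', h4'⟩
      exact ⟨Γ ∪ Γ', h1.union h1', fun p hp a ha =>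
        hp.imp (fun hp => h2 p hp a ha) (fun hp => h2' p hp a ha),
        Set.union_subset_union h3 h3', h4.union h4'⟩
    · rintro p ⟨hp1, hpS⟩
      have hp0 : p ≠ 0 := by
        rintro rfl
        simp at hp1
      obtain ⟨Γ, h1, h2, h3, h4⟩ := h p hpS hp0
      exact ⟨Γ, mem_nhdsWithin_of_mem_nhds (h1.mem_nhds h3), Γ, h1, h2, subset_rfl, h4⟩
  have hSΓ : S \ {0} ⊆ Γ := by
    rintro p ⟨hp, hp0⟩
    have hn : 0 < ‖p‖ := norm_pos_iff.2 hp0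
    have h1 : ‖p‖⁻¹ • p ∈ Γ := hsub ⟨by
      rw [mem_sphere_zero_iff_norm, norm_smul, norm_inv, norm_norm, inv_mul_cancel₀ hn.ne'],
      hcone p hp _ (inv_pos.2 hn)⟩
    have h2 := hΓc _ h1 _ hn
    rwa [smul_smul, mul_inv_cancel₀ hn.ne', one_smul] at h2
  -- The unit ball covers the apex, which the cone Γ may miss; there the polynomial bound suffices.
  refine ⟨Γ ∪ Metric.ball 0 1, Γ, hΓ.union Metric.isOpen_ball, fun p hp => ?_, hΓ, hΓc, hSΓ,
    Set.subset_union_left, hrd.union fun N => ?_⟩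
  · by_cases hp0 : p = 0
    · exact Or.inr (by simp [hp0])
    · exact Or.inl (hSΓ ⟨hp, hp0⟩)
  · obtain ⟨L, C, hC, hf⟩ := hf
    refine ⟨2 ^ N * (C * 2 ^ L), fun p hp => ?_⟩
    rw [mem_ball_zero_iff] at hp
    have h2 : 1 + ‖p‖ ≤ 2 := by linarith
    gcongr
    exact (hf p).trans (by gcongr)

end PolynomialGrowth

/-! ### Plane waves and distributions on powers of Minkowski space -/

section TensorPlaneWaves

variable {ι κ : Type} [Fintype ι] [Fintype κ]

theorem planeWave_mpow_apply (ξ x : MPow ι) :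
    (planeWave ξ : MPow ι → ℂ) x = ∏ j, (planeWave (ξ j) : M → ℂ) (x j) := by
  simp only [planeWave_apply]
  rw [← Complex.exp_sum, PiLp.inner_apply]
  push_cast
  rw [Finset.mul_sum, Finset.sum_neg_distrib]

/-- The real and the imaginary part of the conjugate of a plane wave. -/
def trigConfig (ξ : M) (b : Bool) : Config :=
  ⟨fun x => bif b then Real.cos (inner ℝ ξ x) else Real.sin (inner ℝ ξ x), by
    have h : ContDiff ℝ ∞ fun x : M => inner ℝ ξ x := contDiff_const.inner ℝ contDiff_id
    cases b
    · exact Real.contDiff_sin.comp h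
    · exact Real.contDiff_cos.comp h⟩

theorem planeWave_eq_trigConfig (ξ x : M) :
    (planeWave ξ : M → ℂ) x = ∑ b : Bool, (bif b then 1 else -Complex.I) *
      (((trigConfig ξ b : M → ℝ) x : ℝ) : ℂ) := by
  rw [planeWave_apply, Fintype.sum_bool]
  change _ = 1 * ((Real.cos (inner ℝ ξ x) : ℝ) : ℂ) +
    -Complex.I * ((Real.sin (inner ℝ ξ x) : ℝ) : ℂ)
  have h : -(Complex.I * ((inner ℝ ξ x : ℝ) : ℂ)) = ((-inner ℝ ξ x : ℝ) : ℂ) * Complex.I := by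
    push_cast
    ring
  rw [h, Complex.exp_mul_I, ← Complex.ofReal_cos, ← Complex.ofReal_sin, Real.cos_neg,
    Real.sin_neg]
  push_cast
  ring

/-- A compactly supported distribution on a power of Minkowski space whose values on real tensor
products are known has a known Fourier transform. -/
theorem fourier_eq_of_tensorFn_eq {Ψ Ψ' : CompactDistribution (MPow ι)}
    (h : ∀ c : ι → Config, Ψ.toLin (tensorFn c) = Ψ'.toLin (tensorFn c)) :
    fourier Ψ = fourier Ψ' := by
  classical
  funext ξ
  -- Configurations are real, so each factor is split into cosine and sine and the product is
  -- expanded.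
  have hexp : planeWave ξ = ∑ β ∈ Fintype.piFinset fun _ : ι => (Finset.univ : Finset Bool),
      (∏ j, bif β j then (1 : ℂ) else -Complex.I) • tensorFn fun j => trigConfig (ξ j) (β j) := by
    ext x
    rw [AddSubmonoidClass.coe_finsetSum, Finset.sum_apply, planeWave_mpow_apply]
    simp only [planeWave_eq_trigConfig]
    rw [Finset.prod_univ_sum]
    refine Finset.sum_congr rfl fun β _ => ?_
    rw [Finset.prod_mul_distrib]
    rfl
  simp only [fourier, hexp, map_sum, map_smul, h]

/-- The linear map `x ↦ (x (f w))_w`. -/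
def reindex (f : κ → ι) : MPow ι →L[ℝ] MPow κ :=
  ((PiLp.continuousLinearEquiv 2 ℝ fun _ : κ => M).symm : (κ → M) →L[ℝ] MPow κ).comp
    (ContinuousLinearMap.pi fun w => PiLp.proj 2 (fun _ : ι => M) (f w))

@[simp]
theorem reindex_apply (f : κ → ι) (x : MPow ι) (w : κ) : reindex f x w = x (f w) := rfl

theorem map_reindex_tensorFn (Ψ : CompactDistribution (MPow ι)) (e : κ ≃ ι) (h : κ → Config) :
    (Ψ.map (reindex e)).toLin (tensorFn h) = Ψ.toLin (tensorFn fun i => h (e.symm i)) := by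
  rw [CompactDistribution.map_toLin]
  congr 1
  ext x
  rw [Smooth.compCLM_apply, tensorFn_apply, tensorFn_apply]
  exact Fintype.prod_equiv e _ _ fun w => by simp

theorem fourier_map_reindex (Ψ : CompactDistribution (MPow ι)) (e : κ ≃ ι) (ξ : MPow κ) :
    fourier (Ψ.map (reindex e)) ξ = fourier Ψ (reindex e.symm ξ) := by
  rw [fourier, CompactDistribution.map_toLin, fourier]
  congr 1
  ext x
  rw [Smooth.compCLM_apply, planeWave_mpow_apply, planeWave_mpow_apply]
  exact Fintype.prod_equiv e _ _ fun w => by simp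

/-- The tensor product of compactly supported distributions on powers of Minkowski space. -/
theorem exists_sigma_product {n : ℕ} {d : Fin n → ℕ}
    (T : ∀ i, CompactDistribution (MPow (Fin (d i)))) :
    ∃ R : CompactDistribution (MPow (Σ i, Fin (d i))),
      (∀ h : (Σ i, Fin (d i)) → Config,
        R.toLin (tensorFn h) = ∏ i, (T i).toLin (tensorFn fun j => h ⟨i, j⟩)) ∧
      ∀ ξ, fourier R ξ = ∏ i, fourier (T i) (reindex (Sigma.mk i) ξ) := by
  obtain ⟨R, hR⟩ := CompactDistribution.exists_piOuter T
  let A : (∀ i, MPow (Fin (d i))) →L[ℝ] MPow (Σ i, Fin (d i)) :=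
    ((PiLp.continuousLinearEquiv 2 ℝ fun _ : Σ i, Fin (d i) => M).symm :
      ((Σ i, Fin (d i)) → M) →L[ℝ] MPow (Σ i, Fin (d i))).comp
      (ContinuousLinearMap.pi fun w => (PiLp.proj 2 (fun _ : Fin (d w.1) => M) w.2).comp
        (ContinuousLinearMap.proj (R := ℝ) (φ := fun i => MPow (Fin (d i))) w.1))
  refine ⟨R.map A, fun h => ?_, fun ξ => ?_⟩
  · rw [← hR, CompactDistribution.map_toLin]
    congr 1
    ext x
    rw [Smooth.compCLM_apply, Smooth.piOuter_apply, tensorFn_apply, Fintype.prod_sigma]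
    rfl
  · simp only [fourier]
    rw [← hR, CompactDistribution.map_toLin]
    congr 1
    ext x
    rw [Smooth.compCLM_apply, Smooth.piOuter_apply, planeWave_mpow_apply, Fintype.prod_sigma]
    simp only [planeWave_mpow_apply]
    rfl

end TensorPlaneWaves

/-! ### Light cones and momentum flow through the vertices -/

section LightCones

theorem forwardCone_time_pos {p : M} (hp : p ∈ forwardCone) (h0 : p ≠ 0) : 0 < p 0 := by
  obtain ⟨h1, h2⟩ := hp
  refine lt_of_le_of_ne h1 fun h => h0 ?_
  rw [← h] at h2
  have h3 : p 1 = 0 := by nlinarith [sq_nonneg (p 1), sq_nonneg (p 2), sq_nonneg (p 3)]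
  have h4 : p 2 = 0 := by nlinarith [sq_nonneg (p 1), sq_nonneg (p 2), sq_nonneg (p 3)]
  have h5 : p 3 = 0 := by nlinarith [sq_nonneg (p 1), sq_nonneg (p 2), sq_nonneg (p 3)]
  ext i
  fin_cases i
  · exact h.symm
  · exact h3
  · exact h4
  · exact h5

theorem neg_mem_forwardCone {p : M} (hp : p ∈ backwardCone) : -p ∈ forwardCone := by
  obtain ⟨h1, h2⟩ := hp
  refine ⟨?_, ?_⟩
  · simpa using h1
  · simpa using h2

theorem smul_mem_forwardCone {p : M} (hp : p ∈ forwardCone) {t : ℝ} (ht : 0 < t) :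
    t • p ∈ forwardCone := by
  obtain ⟨h1, h2⟩ := hp
  refine ⟨mul_nonneg ht.le h1, ?_⟩
  simp only [PiLp.smul_apply, smul_eq_mul, mul_pow, ← mul_add]
  gcongr

theorem smul_mem_backwardCone {p : M} (hp : p ∈ backwardCone) {t : ℝ} (ht : 0 < t) :
    t • p ∈ backwardCone := by
  obtain ⟨h1, h2⟩ := hp
  refine ⟨mul_nonpos_of_nonneg_of_nonpos ht.le h1, ?_⟩
  simp only [PiLp.smul_apply, smul_eq_mul, mul_pow, ← mul_add]
  gcongr

theorem isClosed_forwardCone : IsClosed forwardCone := by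
  have h1 : IsClosed {p : M | 0 ≤ p 0} := isClosed_le continuous_const (by fun_prop)
  have h2 : IsClosed {p : M | p 1 ^ 2 + p 2 ^ 2 + p 3 ^ 2 ≤ p 0 ^ 2} :=
    isClosed_le (by fun_prop) (by fun_prop)
  exact h1.inter h2

theorem isClosed_backwardCone : IsClosed backwardCone := by
  have h1 : IsClosed {p : M | p 0 ≤ 0} := isClosed_le (by fun_prop) continuous_const
  have h2 : IsClosed {p : M | p 1 ^ 2 + p 2 ^ 2 + p 3 ^ 2 ≤ p 0 ^ 2} :=
    isClosed_le (by fun_prop) (by fun_prop)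
  exact h1.inter h2

theorem isClosed_coneUnion (k : ℕ) : IsClosed (coneUnion k) := by
  have h : ∀ l : Fin k, Continuous fun P : MPow (Fin k) => P l := fun l => by fun_prop
  refine IsClosed.union ?_ ?_
  · rw [Set.ofPred_forall]
    exact isClosed_iInter fun l => isClosed_forwardCone.preimage (h l)
  · rw [Set.ofPred_forall]
    exact isClosed_iInter fun l => isClosed_backwardCone.preimage (h l)

theorem isConic_coneUnion (k : ℕ) : IsConic (coneUnion k) := fun _ hP _ ht =>
  hP.imp (fun h l => smul_mem_forwardCone (h l) ht) (fun h l => smul_mem_backwardCone (h l) ht)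

/-- The linear map `P ↦ (-P, P)`. -/
def negPairCLM (k : ℕ) : MPow (Fin k) →L[ℝ] MPow (Fin k ⊕ Fin k) :=
  ((PiLp.continuousLinearEquiv 2 ℝ fun _ : Fin k ⊕ Fin k => M).symm :
    (Fin k ⊕ Fin k → M) →L[ℝ] MPow (Fin k ⊕ Fin k)).comp
    (ContinuousLinearMap.pi (Sum.elim (fun l => -PiLp.proj 2 (fun _ : Fin k => M) l)
      (fun l => PiLp.proj 2 (fun _ : Fin k => M) l)))

theorem negPairCLM_apply {k : ℕ} (P : MPow (Fin k)) : negPairCLM k P = negPair P := by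
  ext w : 1
  cases w <;> rfl

/-- The momenta `(-P, P)` flowing into the vertex `i`. -/
def vertexMomenta {n k : ℕ} {d : Fin (n + 1) → ℕ} (e : Fin k ⊕ Fin k ≃ Σ i, Fin (d i))
    (i : Fin (n + 1)) : MPow (Fin k) →L[ℝ] MPow (Fin (d i)) :=
  (reindex (Sigma.mk i)).comp ((reindex e.symm).comp (negPairCLM k))

theorem vertexMomenta_apply {n k : ℕ} {d : Fin (n + 1) → ℕ}
    (e : Fin k ⊕ Fin k ≃ Σ i, Fin (d i)) (i : Fin (n + 1)) (P : MPow (Fin k)) (j : Fin (d i)) :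
    vertexMomenta e i P j = negPair P (e.symm ⟨i, j⟩) := by
  rw [← negPairCLM_apply]
  rfl

/-- At the first vertex that is met by a nonvanishing momentum, the total momentum does not
vanish. -/
theorem exists_sum_vertexMomenta_ne_zero_of_forward {n k : ℕ} {s r : Fin k → Fin (n + 1)}
    (hsr : ∀ l, s l < r l) {d : Fin (n + 1) → ℕ} (e : Fin k ⊕ Fin k ≃ Σ i, Fin (d i))
    (he : ∀ w, (e w).1 = Sum.elim s r w) {P : MPow (Fin k)} (hP : ∀ l, P l ∈ forwardCone)
    (h0 : P ≠ 0) : ∃ i, ∑ j, vertexMomenta e i P j ≠ 0 := by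
  classical
  have hne : (Finset.univ.filter fun l => P l ≠ 0).Nonempty := by
    by_contra hn
    rw [Finset.not_nonempty_iff_eq_empty, Finset.filter_eq_empty_iff] at hn
    refine h0 ?_
    ext l : 1
    simpa using hn (Finset.mem_univ l)
  -- The earliest source vertex of a line with nonzero momentum.
  obtain ⟨l₀, hl₀, hmin⟩ := Finset.exists_min_image _ s hne
  have hl₀' : P l₀ ≠ 0 := (Finset.mem_filter.1 hl₀).2
  refine ⟨(e (Sum.inl l₀)).1, fun hsum => ?_⟩
  have hneg : ∑ j, (vertexMomenta e (e (Sum.inl l₀)).1 P j) 0 < 0 := by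
    refine Finset.sum_neg' (fun j _ => ?_) ⟨(e (Sum.inl l₀)).2, Finset.mem_univ _, ?_⟩
    · rw [vertexMomenta_apply]
      have hv := he (e.symm ⟨(e (Sum.inl l₀)).1, j⟩)
      rw [Equiv.apply_symm_apply] at hv
      replace hv := (he (Sum.inl l₀)).symm.trans hv
      cases hw : e.symm ⟨(e (Sum.inl l₀)).1, j⟩ with
      | inl l => exact neg_nonpos.2 (hP l).1
      | inr l =>
        rw [hw] at hv
        simp only [Sum.elim_inl, Sum.elim_inr] at hv
        -- A line ending at this vertex starts strictly earlier, so by minimality it carries no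
        -- momentum.
        have hz : P l = 0 := by
          by_contra hne
          exact absurd (hmin l (by simp [hne])) (not_le.2 (hv ▸ hsr l))
        change P l 0 ≤ 0
        rw [hz]
        exact le_rfl
    · rw [vertexMomenta_apply]
      have hw : e.symm ⟨(e (Sum.inl l₀)).1, (e (Sum.inl l₀)).2⟩ = Sum.inl l₀ :=
        e.symm_apply_apply _
      rw [hw]
      exact neg_neg_iff_pos.2 (forwardCone_time_pos (hP l₀) hl₀')
  refine hneg.ne ?_
  have h := congrArg (fun p : M => p 0) hsum
  simpa using h

/-- The vertex momenta are linear in P, so P ↦ -P reduces the backward cone to the forward one. -/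
theorem exists_sum_vertexMomenta_ne_zero {n k : ℕ} {s r : Fin k → Fin (n + 1)}
    (hsr : ∀ l, s l < r l) {d : Fin (n + 1) → ℕ} (e : Fin k ⊕ Fin k ≃ Σ i, Fin (d i))
    (he : ∀ w, (e w).1 = Sum.elim s r w) {P : MPow (Fin k)} (hP : P ∈ coneUnion k)
    (h0 : P ≠ 0) : ∃ i, ∑ j, vertexMomenta e i P j ≠ 0 := by
  rcases hP with hP | hP
  · exact exists_sum_vertexMomenta_ne_zero_of_forward hsr e he hP h0
  · obtain ⟨i, hi⟩ := exists_sum_vertexMomenta_ne_zero_of_forward hsr e he (P := -P)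
      (fun l => neg_mem_forwardCone (hP l)) (neg_ne_zero.2 h0)
    refine ⟨i, fun h => hi ?_⟩
    simp only [map_neg, PiLp.neg_apply, Finset.sum_neg_distrib, h, neg_zero]

/-- The contribution of one assignment of the momenta to the vertices decreases rapidly near
every nonzero point of the union of the light cones. -/
theorem rapidNear_prod_vertices {n k : ℕ} {s r : Fin k → Fin (n + 1)}
    (hsr : ∀ l, s l < r l) {d : Fin (n + 1) → ℕ} (T : ∀ i, CompactDistribution (MPow (Fin (d i))))
    (hT : ∀ i, ∀ z ∈ waveFrontSet (T i), ∑ j, z.2 j = 0)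
    (e : Fin k ⊕ Fin k ≃ Σ i, Fin (d i)) (he : ∀ w, (e w).1 = Sum.elim s r w)
    {P₀ : MPow (Fin k)} (hP₀ : P₀ ∈ coneUnion k) (h0 : P₀ ≠ 0) :
    RapidNear (fun P => ∏ i, fourier (T i) (vertexMomenta e i P)) P₀ := by
  obtain ⟨i, hi⟩ := exists_sum_vertexMomenta_ne_zero hsr e he hP₀ h0
  have hQ : vertexMomenta e i P₀ ≠ 0 := by
    intro h
    rw [h] at hi
    simp at hi
  have h1 : RapidNear (fourier (T i)) (vertexMomenta e i P₀) :=
    (T i).rapidNear_fourier hQ fun x hx => hi (hT i _ hx)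
  have h2 : PolynomiallyBounded fun P => ∏ i' ∈ Finset.univ.erase i,
      fourier (T i') (vertexMomenta e i' P) := PolynomiallyBounded.finset_prod _ fun i' _ =>
    PolynomiallyBounded.comp_clm (T i').exists_norm_fourier_le (vertexMomenta e i')
  have h3 := (h1.comp_clm (vertexMomenta e i) hQ).mul h2
  have heq : (fun P => ∏ i, fourier (T i) (vertexMomenta e i P)) = fun P =>
      fourier (T i) (vertexMomenta e i P) *
        ∏ i' ∈ Finset.univ.erase i, fourier (T i') (vertexMomenta e i' P) :=
    funext fun P => (Finset.mul_prod_erase Finset.univ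
      (fun i' => fourier (T i') (vertexMomenta e i' P)) (Finset.mem_univ i)).symm
  rw [heq]
  exact h3

end LightCones

/-! ### Construction of the derivative distribution -/

section DerivativeDistribution

theorem nodup_slots (k : ℕ) :
    ((List.finRange k).flatMap fun l => [(Sum.inl l : Fin k ⊕ Fin k), Sum.inr l]).Nodup := by
  rw [List.nodup_flatMap]
  refine ⟨fun l _ => by simp, (List.nodup_finRange k).imp fun hab => ?_⟩
  simpa [Function.onFun] using hab.symm

theorem sum_map_ite_eq_sum_filter {α : Type*} (l : List α) (p : α → Prop) [DecidablePred p]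
    (f : α → ℂ) : (l.map fun a => if p a then f a else 0).sum = ((l.filter p).map f).sum := by
  induction l with
  | nil => rfl
  | cons a l ih => by_cases h : p a <;> simp [h, ih]

/-- The derivative of one multilinear contribution to the product of functionals, as a compactly
supported distribution. -/
theorem exists_derivative_of_sigma_product {n k : ℕ} (s r : Fin k → Fin (n + 1))
    {d : Fin (n + 1) → ℕ} (T : ∀ i, CompactDistribution (MPow (Fin (d i)))) :
    ∃ (L : MultilinearMap ℝ (fun _ : Σ i, Fin (d i) => Fin (n + 1) → Config) ℂ)
      (Ψ : CompactDistribution (MPow (Fin k ⊕ Fin k)))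
      (Es : List (Fin k ⊕ Fin k ≃ Σ i, Fin (d i))),
      (∀ φ, L (fun _ => φ) = ∏ i, (T i).toLin (tensorFn fun _ => φ i)) ∧
      (∀ h g, Ψ.toLin (tensorFn (Sum.elim h g)) =
        iteratedFunDeriv s r h g (fun φ => L fun _ => φ) 0) ∧
      (∀ e ∈ Es, ∀ w, (e w).1 = Sum.elim s r w) ∧
      ∀ P, fourier Ψ (negPair P) =
        (Es.map fun e => ∏ i, fourier (T i) (vertexMomenta e i P)).sum := by
  classical
  obtain ⟨R, hR, hRF⟩ := exists_sigma_product T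
  let L := tensorMultilinear R (fun w : Σ i, Fin (d i) => w.1)
  obtain ⟨Es, hEs⟩ := exists_foldr_lineDeriv_zero_eq (ι := Σ i, Fin (d i))
    (V := Fin (n + 1) → Config) ((List.finRange k).flatMap fun l => [Sum.inl l, Sum.inr l])
    (nodup_slots k)
    (by rintro (l | l) <;> simp)
  -- A direction supported in one field argument vanishes in the slots of every other functional, so
  -- only the compatible assignments contribute.
  let Es' := Es.filter fun e => ∀ w, (e w).1 = Sum.elim s r w
  obtain ⟨Ψ, hΨ⟩ := CompactDistribution.exists_sum Es' fun e => R.map (reindex e)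
  refine ⟨L, Ψ, Es', fun φ => hR _, fun h g => ?_, fun e he => ?_, fun P => ?_⟩
  · rw [iteratedFunDeriv_eq_foldr, hEs, hΨ]
    simp only [map_reindex_tensorFn]
    have hterm : ∀ e : Fin k ⊕ Fin k ≃ Σ i, Fin (d i),
        (L fun i => Pi.single (Sum.elim s r (e.symm i)) (Sum.elim h g (e.symm i))) =
          if ∀ w, (e w).1 = Sum.elim s r w then
            R.toLin (tensorFn fun i => Sum.elim h g (e.symm i)) else 0 := by
      intro e
      split_ifs with hc
      · change R.toLin (tensorFn _) = _
        congr 2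
        funext i
        change (Pi.single (Sum.elim s r (e.symm i)) (Sum.elim h g (e.symm i)) :
          Fin (n + 1) → Config) i.1 = _
        have h1 : Sum.elim s r (e.symm i) = i.1 := by rw [← hc, Equiv.apply_symm_apply]
        rw [← h1, Pi.single_eq_same]
      · push Not at hc
        obtain ⟨w, hw⟩ := hc
        change R.toLin (tensorFn _) = _
        have h0 : (tensorFn fun i : Σ i, Fin (d i) => (Pi.single (Sum.elim s r (e.symm i))
            (Sum.elim h g (e.symm i)) : Fin (n + 1) → Config) i.1) = 0 := by
          ext x
          rw [tensorFn_apply]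
          refine Finset.prod_eq_zero (Finset.mem_univ (e w)) ?_
          rw [Equiv.symm_apply_apply, Pi.single_eq_of_ne hw]
          exact Complex.ofReal_zero
        rw [h0, map_zero]
    simp only [hterm]
    exact (sum_map_ite_eq_sum_filter Es _ _).symm
  · simpa using (List.mem_filter.1 he).2
  · rw [fourier, hΨ]
    congr 1
    refine List.map_congr_left fun e _ => ?_
    change fourier (R.map (reindex e)) (negPair P) = _
    rw [fourier_map_reindex, hRF, ← negPairCLM_apply]
    rfl

/-- The functional derivative of a tensor product of microcausal functionals is a compactly
supported distribution whose Fourier transform is rapidly decreasing near the light cones. -/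
theorem exists_derivativeDistribution {n k : ℕ} (A : Fin (n + 1) → Config → ℂ)
    (hA : ∀ i, IsMicrocausal (A i)) (s r : Fin k → Fin (n + 1)) (hsr : ∀ l, s l < r l) :
    ∃ Ψ : CompactDistribution (MPow (Fin k ⊕ Fin k)), IsDerivativeDistribution A s r Ψ ∧
      ∀ P ∈ coneUnion k, P ≠ 0 → RapidNear (fun P => fourier Ψ (negPair P)) P := by
  choose m d T hT hF using hA
  -- Expanding the product of sums, c selects one monomial from each functional.
  choose L Ψ Es hL hΨ hEs hΨF using fun c : ∀ i, Fin (m i) =>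
    exists_derivative_of_sigma_product s r fun i => T i (c i)
  obtain ⟨Ψ', hΨ'⟩ := CompactDistribution.exists_sum
    (Finset.univ : Finset (∀ i, Fin (m i))).toList Ψ
  refine ⟨Ψ', fun h g => ?_, fun P hP h0 => ?_⟩
  · have hsum : tensorFunctional A = fun φ => ∑ c : ∀ i, Fin (m i), L c fun _ => φ := by
      funext φ
      simp only [hL, tensorFunctional, hF]
      rw [Finset.prod_univ_sum, Fintype.piFinset_univ]
    rw [hΨ', Finset.sum_map_toList, hsum, iteratedFunDeriv_eq_foldr,
      foldr_lineDeriv_sum _ L _ _ (nodup_slots k)]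
    simp only [hΨ, iteratedFunDeriv_eq_foldr]
  · simp only [fourier] at hΨF ⊢
    simp only [hΨ', hΨF]
    exact RapidNear.list_sum _ fun c _ => RapidNear.list_sum _ fun e he =>
      rapidNear_prod_vertices hsr _ (fun i => hT i (c i)) e (hEs c e he) hP h0

end DerivativeDistribution

end Microcausal

end

theorem mainTheorem12 (n k : ℕ) (A : Fin (n + 1) → Microcausal.Config → ℂ)
    (hA : ∀ i, Microcausal.IsMicrocausal (A i))
    (s r : Fin k → Fin (n + 1)) (hsr : ∀ l, s l < r l) :
    (∃ Ψ : Microcausal.CompactDistribution (Microcausal.MPow (Fin k ⊕ Fin k)),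
      Microcausal.IsDerivativeDistribution A s r Ψ) ∧
    ∀ Ψ : Microcausal.CompactDistribution (Microcausal.MPow (Fin k ⊕ Fin k)),
      Microcausal.IsDerivativeDistribution A s r Ψ →
      ∃ U Γ : Set (Microcausal.MPow (Fin k)),
        IsOpen U ∧ Microcausal.coneUnion k ⊆ U ∧
        IsOpen Γ ∧ Microcausal.IsConic Γ ∧ Microcausal.coneUnion k \ {0} ⊆ Γ ∧ Γ ⊆ U ∧
        Microcausal.RapidlyDecreasingOn
          (fun P => Microcausal.fourier Ψ (Microcausal.negPair P)) U := by
  obtain ⟨Ψ₀, hΨ₀, hrap⟩ := Microcausal.exists_derivativeDistribution A hA s r hsr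
  refine ⟨⟨Ψ₀, hΨ₀⟩, fun Ψ hΨ => ?_⟩
  -- Both distributions agree on real tensor products, hence have the same Fourier transform.
  have hF : Microcausal.fourier Ψ = Microcausal.fourier Ψ₀ :=
    Microcausal.fourier_eq_of_tensorFn_eq fun c => by
      have h := (hΨ (fun l => c (Sum.inl l)) fun l => c (Sum.inr l)).trans
        (hΨ₀ (fun l => c (Sum.inl l)) fun l => c (Sum.inr l)).symm
      have hc : Sum.elim (fun l => c (Sum.inl l)) (fun l => c (Sum.inr l)) = c := by
        funext w
        cases w <;> rfl
      rwa [hc] at h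
  refine Microcausal.exists_isOpen_rapidlyDecreasingOn (Microcausal.isClosed_coneUnion k)
    (Microcausal.isConic_coneUnion k) ?_ ?_
  · have h : Microcausal.PolynomiallyBounded fun P =>
        Microcausal.fourier Ψ (Microcausal.negPairCLM k P) :=
      Microcausal.PolynomiallyBounded.comp_clm Ψ.exists_norm_fourier_le _
    simpa only [Microcausal.negPairCLM_apply] using h
  · rw [hF]
    exact hrap
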